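/- Let $R$ be a commutative local ring whose maximal ideal $\mathfrak m=(p)$ is principal and nonzero and satisfies $\mathfrak m^2=0$. Let $\mathscr C$ be the category of finitely generated free $R$-modules, $\Sigma\colon\mathscr C\to\mathscr C$ the identity functor and $n\ge 3$ an integer. An *$n$-$\Sigma$-sequence* $A_\bullet$ is a sequence of morphisms $A_1\xrightarrow{\alpha_1}A_2\xrightarrow{\alpha_2}\cdots\xrightarrow{\alpha_{n-1}}A_n\xrightarrow{\alpha_n}\Sigma A_1$ in $\mathscr C$. Its *left rotation* is $A_2\xrightarrow{\alpha_2}\cdots\xrightarrow{\alpha_n}\Sigma A_1\xrightarrow{(-1)^n\Sigma\alpha_1}\Sigma A_2$. A *morphism* $\varphi\colon A_\bullet\to B_\bullet$ is a tuple of morphisms $\varphi_i\colon A_i\to B_i$ ($1\le i\le n$) with $\varphi_{i+1}\alpha_i=\beta_i\varphi_i$ for $1\le i\le n$, where $\varphi_{n+1}=\Sigma\varphi_1$; it is an *isomorphism* if all $\varphi_i$ are isomorphisms. Its *mapping cone* is the $n$-$\Sigma$-sequence $A_2\oplus B_1\to A_3\oplus B_2\to\cdots\to\Sigma A_1\oplus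 B_n\to\Sigma A_2\oplus\Sigma B_1$ with maps $\begin{bmatrix}-\alpha_{i+1}&0\\ \varphi_{i+1}&\beta_i\end{bmatrix}$ for $1\le i\le n$, where $\alpha_{n+1}=\Sigma\alpha_1$. The sequence $A_\bullet$ is a *candidate $n$-angle* if $\alpha_{i+1}\alpha_i=0$ for $1\le i\le n$, and *contractible* if there are morphisms $\Theta_i\colon A_{i+1}\to A_i$ ($1\le i\le n$, $A_{n+1}=\Sigma A_1$) with $1_{A_i}=\Theta_i\alpha_i+\alpha_{i-1}\Theta_{i-1}$ for $2\le i\le n$ and $1_{\Sigma A_1}=\Sigma\Theta_1\,\Sigma\alpha_1+\alpha_n\Theta_n$. An *$n$-angulation* of $(\mathscr C,\Sigma)$ is a collection $\mathscr N$ of $n$-$\Sigma$-sequences such that: (N1) $\mathscr N$ is closed under direct sums, direct summands and isomorphisms; it contains $A\xrightarrow{1}A\to0\to\cdots\to0\to\Sigma A$ for every $A\in\mathscr C$; and every morphism of $\mathscr C$ is the first morphism of some member of $\mathscr N$; (N2) a sequence belongs to $\mathscr N$ if and only if its left rotation does; (N3) for $A_\bullet,B_\bullet\in\mathscr N$, any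 $\varphi_1\colon A_1\to B_1$ and $\varphi_2\colon A_2\to B_2$ with $\varphi_2\alpha_1=\beta_1\varphi_1$ can be completed to a morphism $(\varphi_1,\dots,\varphi_n)\colon A_\bullet\to B_\bullet$; (N4) in (N3) the morphisms $\varphi_3,\dots,\varphi_n$ can be chosen such that the mapping cone belongs to $\mathscr N$. In this case $(\mathscr C,\Sigma,\mathscr N)$ is called an *$n$-angulated category*. For each unit $u\in R$, let $\mathscr N_u$ be the collection of all $n$-$\Sigma$-sequences isomorphic to a direct sum of a contractible candidate $n$-angle and a sequence $$F\xrightarrow{up}F\xrightarrow{p}\cdots\xrightarrow{p}F\xrightarrow{p}\Sigma F$$ with $F\in\mathscr C$, whose first map is multiplication by $up$ and whose other maps are multiplication by $p$. Then: 1. $(\mathscr C,\Sigma,\mathscr N_u)$ is an $n$-angulated category for every unit $u\in R$ whenever $n$ is even, or $n$ is odd and $2p=0$ in $R$. 2. If $\mathscr N$ is any $n$-angulation of $(\mathscr C,\Sigma)$, then $\mathscr N=\mathscr N_u$ for some unit $u\in R$. 3. For units $u,v\in R$, $\mathscr N_u=\mathscr N_v$ if and only if $up=vp$ in $R$. -/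

import Mathlib

open CategoryTheory CategoryTheory.Limits

universe v u

/-! ### Sequences over an additive category whose suspension is the identity functor -/

section General

variable (C : Type u) [Category.{v} C] [Preadditive C] (n : ℕ)

/-- An `n`-`Σ`-sequence `A_1 ⟶ A_2 ⟶ ⋯ ⟶ A_n ⟶ Σ A_1` in `C`, for `Σ` the identity functor of `C`.
The labels `1, …, n` are read modulo `n`: the map labelled `n = 0` goes from `A_n` to
`A_{n + 1} = Σ A_1 = A_1`. No condition is imposed on the composites. -/
structure NSigmaSeq where
  /-- the objects `A_1, …, A_n` -/
  obj : ZMod n → C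
  /-- the maps `α_1, …, α_n` -/
  map : ∀ i : ZMod n, obj i ⟶ obj (i + 1)

variable {C n}

namespace NSigmaSeq

/-- A morphism of `n`-`Σ`-sequences: `φ_1, …, φ_n` such that all squares commute, the last one being
the square with vertical maps `φ_n` and `Σ φ_1 = φ_1`. -/
@[ext]
structure Hom (A B : NSigmaSeq C n) where
  /-- the components `φ_1, …, φ_n` -/
  app : ∀ i : ZMod n, A.obj i ⟶ B.obj i
  comm : ∀ i : ZMod n, A.map i ≫ app (i + 1) = app i ≫ B.map i

/-- The identity morphism of a sequence. -/
def Hom.id (A : NSigmaSeq C n) : Hom A A where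
  app i := 𝟙 (A.obj i)
  comm i := by simp

/-- The zero morphism between two sequences. -/
def Hom.zero (A B : NSigmaSeq C n) : Hom A B where
  app _ := 0
  comm i := by simp

/-- Two sequences are isomorphic if there is a morphism all of whose components are isomorphisms. -/
def Isomorphic (A B : NSigmaSeq C n) : Prop :=
  ∃ φ : Hom A B, ∀ i, IsIso (φ.app i)

/-- Two morphisms are homotopic if there are diagonal maps `Θ_i : A_{i + 1} ⟶ B_i` with
`φ_{i + 1} - ψ_{i + 1} = Θ_{i + 1} ∘ α_{i + 1} + β_i ∘ Θ_i` for `i = 1, …, n`, where for `i = n` this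
is the relation `Σ φ_1 - Σ ψ_1 = Σ Θ_1 ∘ Σ α_1 + β_n ∘ Θ_n`. -/
def Homotopic {A B : NSigmaSeq C n} (φ ψ : Hom A B) : Prop :=
  ∃ Θ : ∀ i : ZMod n, A.obj (i + 1) ⟶ B.obj i, ∀ i : ZMod n,
    φ.app (i + 1) - ψ.app (i + 1) = A.map (i + 1) ≫ Θ (i + 1) + Θ i ≫ B.map i

/-- A sequence is contractible if its identity morphism is nullhomotopic. -/
def IsContractible (A : NSigmaSeq C n) : Prop :=
  Homotopic (Hom.id A) (Hom.zero A A)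

/-- Candidate `n`-angles: all the composites `α_2 α_1, …, α_n α_{n - 1}, (Σ α_1) α_n` vanish. -/
def IsCandidate (A : NSigmaSeq C n) : Prop :=
  ∀ i : ZMod n, A.map i ≫ A.map (i + 1) = 0

/-- The left rotation `A_2 ⟶ A_3 ⟶ ⋯ ⟶ A_n ⟶ Σ A_1 ⟶ Σ A_2`, whose maps are
`α_2, …, α_n, (-1) ^ n Σ α_1`. -/
def leftRotation (A : NSigmaSeq C n) : NSigmaSeq C n where
  obj i := A.obj (i + 1)
  map i := if i = 0 then ((-1 : ℤ) ^ n) • A.map (i + 1) else A.map (i + 1)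

/-- `T` is, up to isomorphism, the trivial sequence `X ⟶ X ⟶ 0 ⟶ ⋯ ⟶ 0 ⟶ Σ X` whose first map is
the identity. -/
def IsTrivialOn (T : NSigmaSeq C n) (X : C) : Prop :=
  (∃ (e : T.obj 1 ≅ X) (f : T.obj (1 + 1) ≅ X), T.map 1 ≫ f.hom = e.hom) ∧
    ∀ i : ZMod n, i ≠ 1 → i ≠ 1 + 1 → IsZero (T.obj i)

variable [HasBinaryBiproducts C]

/-- The direct sum of two sequences. -/
noncomputable def directSum (A B : NSigmaSeq C n) : NSigmaSeq C n where
  obj i := A.obj i ⊞ B.obj i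
  map i := biprod.map (A.map i) (B.map i)

/-- The mapping cone of `φ : A ⟶ B`. Its `i`-th map `A_{i + 1} ⊞ B_i ⟶ A_{i + 2} ⊞ B_{i + 1}` has
the matrix with rows `(-α_{i + 1}, 0)` and `(φ_{i + 1}, β_i)`, acting on columns. -/
noncomputable def cone {A B : NSigmaSeq C n} (φ : Hom A B) : NSigmaSeq C n where
  obj i := A.obj (i + 1) ⊞ B.obj i
  map i := biprod.desc
    (biprod.lift (-A.map (i + 1)) (φ.app (i + 1)))
    (biprod.lift 0 (B.map i))

end NSigmaSeq

open NSigmaSeq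

variable [HasBinaryBiproducts C]

/-- The collection `N` is a pre-`n`-angulation of `C` relative to the identity functor. -/
structure IsPreNAngulation (N : Set (NSigmaSeq C n)) : Prop where
  /-- (N1)(a): closure under direct sums -/
  directSum_mem : ∀ A B, A ∈ N → B ∈ N → directSum A B ∈ N
  /-- (N1)(a): closure under direct summands -/
  summand_mem : ∀ A B, directSum A B ∈ N → A ∈ N
  /-- (N1)(a): closure under isomorphisms -/
  iso_mem : ∀ A B, Isomorphic A B → A ∈ N → B ∈ N
  /-- (N1)(b): the trivial sequences belong to `N` -/
  trivial_mem : ∀ (X : C) (T : NSigmaSeq C n), T.IsTrivialOn X → T ∈ N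
  /-- (N1)(c): every morphism is, up to isomorphism, the first map of a member of `N` -/
  exists_first : ∀ {X Y : C} (α : X ⟶ Y), ∃ A ∈ N,
    ∃ (e : A.obj 1 ≅ X) (f : A.obj (1 + 1) ≅ Y), A.map 1 ≫ f.hom = e.hom ≫ α
  /-- (N2): rotation -/
  rotation : ∀ A, A ∈ N ↔ A.leftRotation ∈ N
  /-- (N3): a commutative first square between members of `N` extends to a morphism -/
  exists_hom : ∀ A B, A ∈ N → B ∈ N →
    ∀ (φ₁ : A.obj 1 ⟶ B.obj 1) (φ₂ : A.obj (1 + 1) ⟶ B.obj (1 + 1)),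
      A.map 1 ≫ φ₂ = φ₁ ≫ B.map 1 →
      ∃ φ : Hom A B, φ.app 1 = φ₁ ∧ φ.app (1 + 1) = φ₂

/-- The collection `N` is an `n`-angulation of `C` relative to the identity functor. -/
structure IsNAngulation (N : Set (NSigmaSeq C n)) : Prop extends IsPreNAngulation N where
  /-- (N4): the extension in (N3) can be chosen with its mapping cone in `N` -/
  exists_hom_cone : ∀ A B, A ∈ N → B ∈ N →
    ∀ (φ₁ : A.obj 1 ⟶ B.obj 1) (φ₂ : A.obj (1 + 1) ⟶ B.obj (1 + 1)),
      A.map 1 ≫ φ₂ = φ₁ ≫ B.map 1 →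
      ∃ φ : Hom A B, φ.app 1 = φ₁ ∧ φ.app (1 + 1) = φ₂ ∧ cone φ ∈ N

end General

/-! ### The category of finitely generated free modules -/

/-- Finitely generated free modules, as a property of `R`-modules. -/
def isFGFree (R : Type u) [CommRing R] : ObjectProperty (ModuleCat.{u} R) :=
  fun M => Module.Finite R M ∧ Module.Free R M

/-- The category of finitely generated free `R`-modules. -/
abbrev FGFree (R : Type u) [CommRing R] : Type (u + 1) :=
  (isFGFree R).FullSubcategory

section Additive

variable {R : Type u} [CommRing R]

instance FGFree.hasZeroObject : HasZeroObject (FGFree R) :=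
  ⟨⟨⟨ModuleCat.of R PUnit.{u + 1},
      (inferInstance : Module.Finite R PUnit.{u + 1}), (inferInstance : Module.Free R PUnit.{u + 1})⟩, by
    rw [IsZero.iff_id_eq_zero]
    apply ObjectProperty.hom_ext
    apply ModuleCat.hom_ext
    ext⟩⟩

instance FGFree.hasBinaryBiproducts : HasBinaryBiproducts (FGFree R) where
  has_binary_biproduct X Y := by
    have : Module.Finite R X.obj := X.property.1
    have : Module.Free R X.obj := X.property.2
    have : Module.Finite R Y.obj := Y.property.1
    have : Module.Free R Y.obj := Y.property.2
    refine HasBinaryBiproduct.mk (BinaryBiproductData.mk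
      { pt := ⟨ModuleCat.of R (X.obj × Y.obj),
          (inferInstance : Module.Finite R (X.obj × Y.obj)),
          (inferInstance : Module.Free R (X.obj × Y.obj))⟩
        fst := ObjectProperty.homMk (ModuleCat.ofHom (LinearMap.fst R X.obj Y.obj))
        snd := ObjectProperty.homMk (ModuleCat.ofHom (LinearMap.snd R X.obj Y.obj))
        inl := ObjectProperty.homMk (ModuleCat.ofHom (LinearMap.inl R X.obj Y.obj))
        inr := ObjectProperty.homMk (ModuleCat.ofHom (LinearMap.inr R X.obj Y.obj))
        inl_fst := rfl
        inl_snd := rfl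
        inr_fst := rfl
        inr_snd := rfl } (isBinaryBilimitOfTotal _ ?_))
    apply ObjectProperty.hom_ext
    apply ModuleCat.hom_ext
    refine LinearMap.ext fun x => ?_
    exact Prod.ext (add_zero x.1) (zero_add x.2)

/-- The sequence `F ⟶ F ⟶ ⋯ ⟶ F ⟶ Σ F` whose first map is multiplication by `u * p` and whose other
maps are multiplication by `p`. -/
def freeSeq (n : ℕ) (p u : R) (F : FGFree R) : NSigmaSeq (FGFree R) n where
  obj _ := F
  map i := if i = 1 then (u * p) • 𝟙 F else p • 𝟙 F

/-- The collection of all sequences isomorphic to the direct sum of a contractible candidate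
`n`-angle and a sequence `F ⟶ F ⟶ ⋯ ⟶ F ⟶ Σ F` with first map `u * p` and other maps `p`. -/
def angleClass (n : ℕ) (p u : R) : Set (NSigmaSeq (FGFree R) n) :=
  {A | ∃ (K : NSigmaSeq (FGFree R) n) (F : FGFree R), K.IsCandidate ∧ K.IsContractible ∧
    A.Isomorphic (K.directSum (freeSeq n p u F))}

end Additive

-- Call `F ⟶ F ⟶ ⋯ ⟶ F` with maps `p M, p, …, p` and `M` invertible the minimal sequence with
-- monodromy `M` (`minSeq`). Morphisms of free modules have quasi-inverses over the residue field.
-- Since `p² = 0` these lift to exact outer inverses, so every candidate retracts onto a sequence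
-- with maps `p γ_i`, with contractible complement (`exists_minimal_reduction`). Exactness forces
-- the `γ_i` to be invertible, and transport along them collects them into one monodromy
-- (`exists_reduction_minSeq`).
--
-- Only `p M` matters, and it is an invariant. The components of a morphism of minimal sequences
-- agree after multiplication by `p`, and multiplication by `p` also kills every homotopy term that
-- meets a minimal sequence (`smul_app_minSeq`, `smul_comp_of_factor`). So `𝒩_u` is the class of
-- candidates with monodromy `u`, and its closure under sums and summands follows by factoring
-- identities through members (`mem_of_sum`).
--
-- Rotation multiplies the monodromy by `(-1)^n`, and cones put a sign on the source. Both signs can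
-- be absorbed when `n` is even or `2p = 0`. For (N4), the invertible part of the map induced on
-- minimal sequences is cancelled from the cone. What remains is a multiple of `p`; after correcting
-- one component its cone is again minimal with monodromy `u` (`exists_cone_iso`). Any given square
-- has a completion homotopic to the morphism so constructed (`exists_completion_homotopic`), and
-- homotopic morphisms have isomorphic cones.
--
-- Conversely, (N1)–(N3) force members of an angulation to be exact candidates and contractible
-- candidates to be members. Hence an angulation is determined by its minimal members. It has one on
-- each `F`, and naturality of the monodromy along maps `R ⟶ F` identifies it with the scalar `u`
-- found on `R` (`exists_eq_monodromyClass`).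

universe w

set_option linter.unusedSectionVars false

/-! ### Families indexed by `ZMod n` -/

section Cyclic

variable {n : ℕ}

/-- Induction on `ZMod n` from an arbitrary starting point. -/
theorem ZMod.cyclic_induction [NeZero n] {P : ZMod n → Prop} (j : ZMod n) (h0 : P j)
    (hs : ∀ i, P i → P (i + 1)) (i : ZMod n) : P i := by
  have key : ∀ k : ℕ, P (j + k) := by
    intro k
    induction k with
    | zero => simpa using h0
    | succ k ih =>
      have := hs _ ih
      rwa [add_assoc, ← Nat.cast_succ] at this
  have := key (i - j).val
  rwa [ZMod.natCast_val, ZMod.cast_id, add_sub_cancel] at this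

/-- A family is determined by its values at the successors. -/
theorem ZMod.exists_shift {P : ZMod n → Type*} (q : ∀ i, P (i + 1)) :
    ∃ s : ∀ i, P i, ∀ i, s (i + 1) = q i := by
  refine ⟨fun i => _root_.cast (congrArg P (sub_add_cancel i 1)) (q (i - 1)), fun i => ?_⟩
  have : ∀ j : ZMod n, j = i → ∀ h : P (j + 1) = P (i + 1), _root_.cast h (q j) = q i := by
    rintro j rfl h
    rfl
  exact this _ (add_sub_cancel_right i 1) _

/-- A property of all successors is a property of everything. -/
theorem ZMod.forall_of_forall_succ {P : ZMod n → Prop} (h : ∀ i, P (i + 1)) (i : ZMod n) : P i := by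
  have := h (i - 1)
  rwa [sub_add_cancel] at this

/-- Recursion once around `ZMod n`. -/
theorem ZMod.exists_section [NeZero n] {P : ZMod n → Type*} (j : ZMod n) (x : P j)
    (step : ∀ i, P i → P (i + 1)) :
    ∃ s : ∀ i, P i, s j = x ∧ ∀ i, i + 1 ≠ j → s (i + 1) = step i (s i) := by
  -- The iteration runs in the sigma type because the label reached after `k` steps equals `j + k`
  -- only propositionally.
  let T : ℕ → Σ i, P i := fun k =>
    Nat.rec ⟨j, x⟩ (fun _ y => ⟨y.1 + 1, step y.1 y.2⟩) k
  have hT0 : T 0 = ⟨j, x⟩ := rfl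
  have hTs : ∀ k, T (k + 1) = ⟨(T k).1 + 1, step (T k).1 (T k).2⟩ := fun _ => rfl
  have hT : ∀ k : ℕ, (T k).1 = j + k := by
    intro k
    induction k with
    | zero => simp [hT0]
    | succ k ih =>
      have h : (T (k + 1)).1 = (T k).1 + 1 := rfl
      rw [h, ih]
      push_cast
      ring
  have h1 : ∀ i, (T (i - j).val).1 = i := fun i => by
    rw [hT, ZMod.natCast_val, ZMod.cast_id, add_sub_cancel]
  have hex : ∀ i, ∃ y : P i, T (i - j).val = ⟨i, y⟩ := fun i => by
    have h := h1 i
    revert h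
    generalize T (i - j).val = t
    obtain ⟨a, b⟩ := t
    rintro rfl
    exact ⟨b, rfl⟩
  choose s hs using hex
  refine ⟨s, ?_, fun i hi => ?_⟩
  · have h := hs j
    rw [sub_self, ZMod.val_zero, hT0] at h
    simpa using h.symm
  -- As long as `i + 1 ≠ j` the circle has not closed, so the distance from `j` grows by one without
  -- wrapping around.
  · have hk : (i + 1 - j).val = (i - j).val + 1 := by
      have hlt := ZMod.val_lt (i - j)
      have hc : (((i - j).val + 1 : ℕ) : ZMod n) = i + 1 - j := by
        push_cast
        rw [ZMod.natCast_val, ZMod.cast_id]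
        ring
      have hne : (i - j).val + 1 ≠ n := by
        intro h
        rw [h, ZMod.natCast_self] at hc
        exact hi (sub_eq_zero.mp hc.symm)
      rw [← hc, ZMod.val_natCast, Nat.mod_eq_of_lt (by omega)]
    have h := hs (i + 1)
    rw [hk, hTs, hs i] at h
    simpa using h.symm

theorem ZMod.one_ne_zero_of_three_le (hn : 3 ≤ n) : (1 : ZMod n) ≠ 0 := by
  intro h
  have h' : ((1 : ℕ) : ZMod n) = 0 := by exact_mod_cast h
  rw [ZMod.natCast_eq_zero_iff] at h'
  exact absurd (Nat.le_of_dvd one_pos h') (by omega)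

theorem ZMod.one_add_one_ne_zero_of_three_le (hn : 3 ≤ n) : (1 + 1 : ZMod n) ≠ 0 := by
  intro h
  have h' : ((2 : ℕ) : ZMod n) = 0 := by push_cast; rw [← h]; norm_num
  rw [ZMod.natCast_eq_zero_iff] at h'
  exact absurd (Nat.le_of_dvd two_pos h') (by omega)

end Cyclic

/-! ### Morphisms, isomorphisms and reductions of sequences -/

namespace NSigmaSeq

section Preadditive

variable {C : Type u} [Category.{v} C] [Preadditive C] {n : ℕ}

theorem Hom.comm_assoc {A B : NSigmaSeq C n} (φ : Hom A B) (i : ZMod n) {X : C}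
    (x : B.obj (i + 1) ⟶ X) : A.map i ≫ φ.app (i + 1) ≫ x = φ.app i ≫ B.map i ≫ x := by
  rw [← Category.assoc, φ.comm, Category.assoc]

/-- Composition of morphisms of sequences. -/
def Hom.comp {A B D : NSigmaSeq C n} (φ : Hom A B) (ψ : Hom B D) : Hom A D where
  app i := φ.app i ≫ ψ.app i
  comm i := by rw [φ.comm_assoc, ψ.comm, Category.assoc]

/-- The componentwise inverse of a morphism of sequences. -/
noncomputable def Hom.inverse {A B : NSigmaSeq C n} (φ : Hom A B) (h : ∀ i, IsIso (φ.app i)) :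
    Hom B A where
  app i := inv (φ.app i)
  comm i := by rw [IsIso.comp_inv_eq, Category.assoc, φ.comm, IsIso.inv_hom_id_assoc]

theorem Isomorphic.symm {A B : NSigmaSeq C n} (h : Isomorphic A B) : Isomorphic B A := by
  obtain ⟨φ, hφ⟩ := h
  exact ⟨φ.inverse hφ, fun i => by dsimp [Hom.inverse]; infer_instance⟩

theorem Isomorphic.trans {A B D : NSigmaSeq C n} (h : Isomorphic A B) (h' : Isomorphic B D) :
    Isomorphic A D := by
  obtain ⟨φ, hφ⟩ := h
  obtain ⟨ψ, hψ⟩ := h'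
  exact ⟨φ.comp ψ, fun i => by dsimp [Hom.comp]; infer_instance⟩

theorem Isomorphic.of_inverse {A B : NSigmaSeq C n} (φ : Hom A B) (ψ : ∀ i, B.obj i ⟶ A.obj i)
    (h₁ : ∀ i, φ.app i ≫ ψ i = 𝟙 _) (h₂ : ∀ i, ψ i ≫ φ.app i = 𝟙 _) : Isomorphic A B :=
  ⟨φ, fun i => ⟨ψ i, h₁ i, h₂ i⟩⟩

theorem IsCandidate.of_iso {A B : NSigmaSeq C n} (h : Isomorphic A B) (hA : A.IsCandidate) :
    B.IsCandidate := by
  obtain ⟨φ, hφ⟩ := h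
  intro i
  rw [← cancel_epi (φ.app i), ← φ.comm_assoc, ← φ.comm, ← Category.assoc, hA i, zero_comp,
    comp_zero]

/-- A strong deformation retraction of `A` onto `G`. -/
structure Reduction (G A : NSigmaSeq C n) where
  /-- the inclusion -/
  f : Hom G A
  /-- the retraction -/
  g : Hom A G
  /-- the homotopy -/
  h : ∀ i : ZMod n, A.obj (i + 1) ⟶ A.obj i
  f_g : ∀ i, f.app i ≫ g.app i = 𝟙 _
  homotopy : ∀ i, A.map (i + 1) ≫ h (i + 1) + h i ≫ A.map i =
    𝟙 _ - g.app (i + 1) ≫ f.app (i + 1)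
  f_h : ∀ i, f.app (i + 1) ≫ h i = 0
  h_g : ∀ i, h i ≫ g.app i = 0

attribute [simp] Reduction.f_g Reduction.f_h Reduction.h_g

section

variable {G A : NSigmaSeq C n} (r : Reduction G A)

@[simp]
theorem Reduction.f_g_assoc (i : ZMod n) {X : C} (x : G.obj i ⟶ X) :
    r.f.app i ≫ r.g.app i ≫ x = x := by
  rw [← Category.assoc, r.f_g, Category.id_comp]

@[simp]
theorem Reduction.f_h_assoc (i : ZMod n) {X : C} (x : A.obj i ⟶ X) :
    r.f.app (i + 1) ≫ r.h i ≫ x = 0 := by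
  rw [← Category.assoc, r.f_h, zero_comp]

@[simp]
theorem Reduction.h_g_assoc (i : ZMod n) {X : C} (x : G.obj i ⟶ X) :
    r.h i ≫ r.g.app i ≫ x = 0 := by
  rw [← Category.assoc, r.h_g, zero_comp]

end

/-- Transport of a reduction along an isomorphism of the ambient sequences. -/
noncomputable def Reduction.ofIso {G A B : NSigmaSeq C n} (r : Reduction G A) (φ : Hom A B)
    (hφ : ∀ i, IsIso (φ.app i)) : Reduction G B where
  f := r.f.comp φ
  g := (φ.inverse hφ).comp r.g
  h i := inv (φ.app (i + 1)) ≫ r.h i ≫ φ.app i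
  f_g i := by simp [Hom.comp, Hom.inverse]
  homotopy i := by
    have h := r.homotopy i
    have h1 : B.map (i + 1) ≫ inv (φ.app (i + 1 + 1)) = inv (φ.app (i + 1)) ≫ A.map (i + 1) :=
      (φ.inverse hφ).comm (i + 1)
    simp only [Hom.comp, Hom.inverse, Category.assoc]
    rw [reassoc_of% h1, ← φ.comm]
    have h2 := congrArg (fun t => inv (φ.app (i + 1)) ≫ t ≫ φ.app (i + 1)) h
    simpa [Preadditive.add_comp, Preadditive.sub_comp, Preadditive.comp_add,
      Preadditive.comp_sub] using h2
  f_h i := by simp [Hom.comp]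
  h_g i := by simp [Hom.comp, Hom.inverse]

/-- Transport of a reduction along an isomorphism of the reduced sequences. -/
noncomputable def Reduction.ofIsoLeft {G G' A : NSigmaSeq C n} (r : Reduction G A) (φ : Hom G' G)
    (hφ : ∀ i, IsIso (φ.app i)) : Reduction G' A where
  f := φ.comp r.f
  g := r.g.comp (φ.inverse hφ)
  h := r.h
  f_g i := by simp [Hom.comp, Hom.inverse]
  homotopy i := by simp [Hom.comp, Hom.inverse, r.homotopy]
  f_h i := by simp [Hom.comp]
  h_g i := by rw [Hom.comp, r.h_g_assoc]

/-- Composition maps into a sequence are exact. -/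
def IsExact (A : NSigmaSeq C n) : Prop :=
  ∀ (i : ZMod n) {X : C} (x : X ⟶ A.obj (i + 1)), x ≫ A.map (i + 1) = 0 → ∃ y, x = y ≫ A.map i

/-- Composition maps out of a sequence are exact. -/
def IsCoexact (A : NSigmaSeq C n) : Prop :=
  ∀ (i : ZMod n) {X : C} (x : A.obj (i + 1) ⟶ X), A.map i ≫ x = 0 → ∃ y, x = A.map (i + 1) ≫ y

namespace Reduction

variable {G A : NSigmaSeq C n}

theorem id_eq (r : Reduction G A) (i : ZMod n) :
    𝟙 (A.obj (i + 1)) = A.map (i + 1) ≫ r.h (i + 1) + r.h i ≫ A.map i +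
      r.g.app (i + 1) ≫ r.f.app (i + 1) := by
  rw [r.homotopy, sub_add_cancel]

/-- By the homotopy relation a cycle `x` is a boundary plus the image of its projection to `G`,
which is a boundary there. -/
theorem isExact (r : Reduction G A) (hG : G.IsExact) : A.IsExact := by
  intro i X x hx
  obtain ⟨y, hy⟩ := hG i (x ≫ r.g.app (i + 1)) (by
    rw [Category.assoc, ← r.g.comm, reassoc_of% hx, zero_comp])
  refine ⟨x ≫ r.h i + y ≫ r.f.app i, ?_⟩
  have h := congrArg (fun t => x ≫ t) (r.id_eq i)
  simp only [Category.comp_id, Preadditive.comp_add, reassoc_of% hx, zero_comp, zero_add] at h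
  rw [Preadditive.add_comp, Category.assoc, Category.assoc, ← r.f.comm, ← reassoc_of% hy]
  exact h

/-- Exactness passes to retracts; the homotopy plays no role. -/
theorem isExact_left (r : Reduction G A) (hA : A.IsExact) : G.IsExact := by
  intro i X x hx
  obtain ⟨y, hy⟩ := hA i (x ≫ r.f.app (i + 1)) (by
    rw [Category.assoc, ← r.f.comm, reassoc_of% hx, zero_comp])
  refine ⟨y ≫ r.g.app i, ?_⟩
  rw [Category.assoc, ← r.g.comm, ← reassoc_of% hy, r.f_g, Category.comp_id]

theorem isCoexact (r : Reduction G A) (hG : G.IsCoexact) : A.IsCoexact := by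
  intro i X x hx
  obtain ⟨y, hy⟩ := hG i (r.f.app (i + 1) ≫ x) (by
    rw [r.f.comm_assoc, hx, comp_zero])
  refine ⟨r.h (i + 1) ≫ x + r.g.app (i + 1 + 1) ≫ y, ?_⟩
  have h := congrArg (fun t => t ≫ x) (r.id_eq i)
  simp only [Category.id_comp, Preadditive.add_comp, Category.assoc, hx, comp_zero, add_zero] at h
  rw [Preadditive.comp_add, r.g.comm_assoc, ← hy]
  exact h

end Reduction

end Preadditive

/-! ### Direct sums and split summands -/

section Biproducts

variable {C : Type u} [Category.{v} C] [Preadditive C] [HasBinaryBiproducts C] {n : ℕ}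

/-- The inclusion of the first summand. -/
noncomputable def Hom.inl (A B : NSigmaSeq C n) : Hom A (A.directSum B) where
  app _ := biprod.inl
  comm i := by simp [directSum]

/-- The inclusion of the second summand. -/
noncomputable def Hom.inr (A B : NSigmaSeq C n) : Hom B (A.directSum B) where
  app _ := biprod.inr
  comm i := by simp [directSum]

/-- The projection to the first summand. -/
noncomputable def Hom.fst (A B : NSigmaSeq C n) : Hom (A.directSum B) A where
  app _ := biprod.fst
  comm i := by simp [directSum]

/-- The projection to the second summand. -/
noncomputable def Hom.snd (A B : NSigmaSeq C n) : Hom (A.directSum B) B where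
  app _ := biprod.snd
  comm i := by simp [directSum]

theorem directSum_comm (A B : NSigmaSeq C n) : Isomorphic (A.directSum B) (B.directSum A) :=
  ⟨{ app := fun i => (biprod.braiding (A.obj i) (B.obj i)).hom
     comm := fun i => by
      dsimp +instances [directSum]
      ext <;> simp }, fun i => (biprod.braiding (A.obj i) (B.obj i)).isIso_hom⟩

theorem IsCandidate.directSum {A B : NSigmaSeq C n} (hA : A.IsCandidate) (hB : B.IsCandidate) :
    (A.directSum B).IsCandidate := by
  intro i
  change biprod.map _ _ ≫ biprod.map _ _ =
    (0 : A.obj i ⊞ B.obj i ⟶ A.obj (i + 1 + 1) ⊞ B.obj (i + 1 + 1))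
  ext <;> simp [reassoc_of% (hA i), reassoc_of% (hB i)]

theorem IsCandidate.of_directSum {A B : NSigmaSeq C n} (h : (A.directSum B).IsCandidate) :
    A.IsCandidate := by
  intro i
  have h1 : biprod.map (A.map i) (B.map i) ≫ biprod.map (A.map (i + 1)) (B.map (i + 1)) = 0 := h i
  simpa using congrArg (fun t => biprod.inl ≫ t ≫ biprod.fst) h1

theorem IsExact.directSum {A B : NSigmaSeq C n} (hA : A.IsExact) (hB : B.IsExact) :
    (A.directSum B).IsExact := by
  intro i X x hx
  change X ⟶ A.obj (i + 1) ⊞ B.obj (i + 1) at x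
  change x ≫ biprod.map (A.map (i + 1)) (B.map (i + 1)) = 0 at hx
  obtain ⟨y, hy⟩ := hA i (x ≫ biprod.fst) (by
    simpa using congrArg (fun t => t ≫ biprod.fst) hx)
  obtain ⟨z, hz⟩ := hB i (x ≫ biprod.snd) (by
    simpa using congrArg (fun t => t ≫ biprod.snd) hx)
  refine ⟨biprod.lift y z, ?_⟩
  dsimp +instances [NSigmaSeq.directSum]
  ext <;> simp [hy, hz]

theorem IsExact.of_directSum {A B : NSigmaSeq C n} (h : (A.directSum B).IsExact) :
    A.IsExact := by
  intro i X x hx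
  obtain ⟨y, hy⟩ := h i (x ≫ biprod.inl) (by
    change (x ≫ biprod.inl) ≫ biprod.map (A.map (i + 1)) (B.map (i + 1)) = 0
    simp [reassoc_of% hx])
  change X ⟶ A.obj i ⊞ B.obj i at y
  change x ≫ biprod.inl = y ≫ biprod.map (A.map i) (B.map i) at hy
  refine ⟨y ≫ biprod.fst, ?_⟩
  simpa using congrArg (fun t => t ≫ biprod.fst) hy

/-- Removing a contractible summand. -/
noncomputable def Reduction.ofContractible (K G : NSigmaSeq C n)
    (Θ : ∀ i : ZMod n, K.obj (i + 1) ⟶ K.obj i)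
    (hΘ : ∀ i, 𝟙 _ = K.map (i + 1) ≫ Θ (i + 1) + Θ i ≫ K.map i) :
    Reduction G (K.directSum G) where
  f := Hom.inr K G
  g := Hom.snd K G
  h i := biprod.map (Θ i) 0
  f_g i := biprod.inr_snd
  homotopy i := by
    have := hΘ i
    dsimp +instances [directSum, Hom.inr, Hom.snd]
    ext <;> simp [← this]
  f_h i := by
    change biprod.inr ≫ biprod.map (Θ i) 0 = 0
    simp
  h_g i := by
    change biprod.map (Θ i) 0 ≫ biprod.snd = 0
    simp

theorem IsContractible.exists_homotopy {K : NSigmaSeq C n} (h : K.IsContractible) :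
    ∃ Θ : ∀ i : ZMod n, K.obj (i + 1) ⟶ K.obj i,
      ∀ i, 𝟙 _ = K.map (i + 1) ≫ Θ (i + 1) + Θ i ≫ K.map i := by
  obtain ⟨Θ, hΘ⟩ := h
  exact ⟨Θ, fun i => by simpa [Hom.id, Hom.zero] using hΘ i⟩

theorem exists_reduction_of_iso_directSum {A K G : NSigmaSeq C n} (hK : K.IsContractible)
    (h : Isomorphic A (K.directSum G)) : Nonempty (Reduction G A) := by
  obtain ⟨Θ, hΘ⟩ := hK.exists_homotopy
  obtain ⟨φ, hφ⟩ := h.symm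
  exact ⟨(Reduction.ofContractible K G Θ hΘ).ofIso φ hφ⟩

/-- If idempotents split, a retract of a sequence is a direct summand. -/
theorem exists_iso_directSum
    (hsplit : ∀ {X : C} (e : X ⟶ X), e ≫ e = e → ∃ (P : C) (i : P ⟶ X) (r : X ⟶ P),
      i ≫ r = 𝟙 P ∧ r ≫ i = e)
    {G A : NSigmaSeq C n} (f : Hom G A) (g : Hom A G) (hfg : ∀ i, f.app i ≫ g.app i = 𝟙 _) :
    ∃ (K : NSigmaSeq C n) (i : ∀ j, K.obj j ⟶ A.obj j) (r : ∀ j, A.obj j ⟶ K.obj j),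
      (∀ j, i j ≫ r j = 𝟙 _) ∧ (∀ j, r j ≫ i j = 𝟙 _ - g.app j ≫ f.app j) ∧
      (∀ j, K.map j = i j ≫ A.map j ≫ r (j + 1)) ∧ Isomorphic A (K.directSum G) := by
  have hx : ∀ j, ∃ (P : C) (i : P ⟶ A.obj j) (r : A.obj j ⟶ P),
      i ≫ r = 𝟙 P ∧ r ≫ i = 𝟙 _ - g.app j ≫ f.app j := fun j => hsplit _ (by
    simp [Preadditive.comp_sub, Preadditive.sub_comp, reassoc_of% (hfg j)])
  choose K i r hir hri using hx
  have hig : ∀ j, i j ≫ g.app j = 0 := fun j => by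
    have h : i j = i j ≫ r j ≫ i j := by rw [reassoc_of% (hir j)]
    rw [h, hri]
    simp [Preadditive.comp_sub, Preadditive.sub_comp, hfg j]
  have hfr : ∀ j, f.app j ≫ r j = 0 := fun j => by
    have h : r j = r j ≫ i j ≫ r j := by rw [hir, Category.comp_id]
    rw [h, reassoc_of% (hri j)]
    simp [Preadditive.comp_sub, Preadditive.sub_comp, reassoc_of% (hfg j)]
  refine ⟨⟨K, fun j => i j ≫ A.map j ≫ r (j + 1)⟩, i, r, hir, hri, fun _ => rfl, ?_⟩
  refine .of_inverse ⟨fun j => biprod.lift (r j) (g.app j), fun j => ?_⟩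
    (fun j => biprod.desc (i j) (f.app j)) (fun j => ?_) (fun j => ?_)
  · dsimp +instances [directSum]
    have h1 : r j ≫ i j ≫ A.map j ≫ r (j + 1) = A.map j ≫ r (j + 1) := by
      rw [reassoc_of% (hri j), Preadditive.sub_comp, Category.id_comp, Category.assoc,
        ← f.comm_assoc, hfr, comp_zero, comp_zero, sub_zero]
    ext <;> simp [h1, g.comm]
  · simp [directSum, biprod.lift_desc, hri]
  · dsimp +instances [directSum]
    ext <;> simp [hir, hig, hfr, hfg]

/-- A reduction exhibits a complementary contractible summand. -/
theorem Reduction.exists_iso_directSum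
    (hsplit : ∀ {X : C} (e : X ⟶ X), e ≫ e = e → ∃ (P : C) (i : P ⟶ X) (r : X ⟶ P),
      i ≫ r = 𝟙 P ∧ r ≫ i = e)
    {G A : NSigmaSeq C n} (hA : A.IsCandidate) (s : Reduction G A) :
    ∃ K : NSigmaSeq C n, K.IsCandidate ∧ K.IsContractible ∧ Isomorphic A (K.directSum G) := by
  obtain ⟨K, i, r, hir, hri, hK, h⟩ := NSigmaSeq.exists_iso_directSum hsplit s.f s.g s.f_g
  refine ⟨K, (hA.of_iso h).of_directSum, ⟨fun j => i (j + 1) ≫ s.h j ≫ r j, fun j => ?_⟩, h⟩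
  have h1 : ∀ j {X : C} (x : A.obj (j + 1) ⟶ X),
      A.map j ≫ r (j + 1) ≫ i (j + 1) ≫ x =
        A.map j ≫ x - s.g.app j ≫ s.f.app j ≫ A.map j ≫ x := fun j X x => by
    rw [reassoc_of% (hri (j + 1)), Preadditive.sub_comp, Preadditive.comp_sub, Category.id_comp,
      Category.assoc, s.g.comm_assoc, s.f.comm_assoc]
  have h2 : ∀ j {X : C} (x : A.obj j ⟶ X), s.h j ≫ r j ≫ i j ≫ x = s.h j ≫ x := fun j X x => by
    rw [reassoc_of% (hri j), Preadditive.sub_comp, Preadditive.comp_sub, Category.id_comp,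
      Category.assoc, s.h_g_assoc, sub_zero]
  have h3 : ∀ j, i j ≫ s.g.app j = 0 := fun j => by
    have h : i j = i j ≫ r j ≫ i j := by rw [reassoc_of% (hir j)]
    rw [h, hri]
    simp [Preadditive.comp_sub, Preadditive.sub_comp]
  have h4 := congrArg (fun t => i (j + 1) ≫ t ≫ r (j + 1)) (s.id_eq j)
  simp only [Category.id_comp, hir, Preadditive.comp_add, Preadditive.add_comp, Category.assoc,
    reassoc_of% (h3 (j + 1)), zero_comp, add_zero] at h4
  simp only [Hom.id, Hom.zero, sub_zero, hK, Category.assoc, h1, h2, Preadditive.comp_sub,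
    reassoc_of% (h3 (j + 1)), zero_comp]
  exact h4

/-! ### Mapping cones -/

theorem IsCandidate.cone {A B : NSigmaSeq C n} (hA : A.IsCandidate) (hB : B.IsCandidate)
    (φ : Hom A B) : (cone φ).IsCandidate := by
  intro i
  change biprod.desc _ _ ≫ biprod.desc _ _ =
    (0 : A.obj (i + 1) ⊞ B.obj i ⟶ A.obj (i + 1 + 1 + 1) ⊞ B.obj (i + 1 + 1))
  ext <;> simp [hA (i + 1), hB i, φ.comm]

/-- Homotopic morphisms have isomorphic cones. -/
theorem cone_iso_of_homotopy {A B : NSigmaSeq C n} (φ ψ : Hom A B)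
    (Θ : ∀ i : ZMod n, A.obj (i + 1) ⟶ B.obj i)
    (h : ∀ i, φ.app (i + 1) = ψ.app (i + 1) + (A.map (i + 1) ≫ Θ (i + 1) + Θ i ≫ B.map i)) :
    Isomorphic (cone φ) (cone ψ) := by
  refine .of_inverse ⟨fun i => biprod.desc (biprod.lift (𝟙 _) (Θ i)) biprod.inr, fun i => ?_⟩
    (fun i => biprod.desc (biprod.lift (𝟙 _) (-Θ i)) biprod.inr) (fun i => ?_) (fun i => ?_)
  · have := h i
    dsimp +instances [cone]
    ext <;> simp [this]
    abel
  · dsimp +instances [cone]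
    ext <;> simp
  · dsimp +instances [cone]
    ext <;> simp

/-- Perturbation lemma for mapping cones. -/
noncomputable def Reduction.cone {A B A' B' : NSigmaSeq C n} (φ : Hom A B) (φ' : Hom A' B')
    (f : Hom A' A) (g : Hom A A') (f' : Hom B' B) (g' : Hom B B') (s : Hom B A)
    (h : ∀ i : ZMod n, A.obj (i + 1) ⟶ A.obj i) (h' : ∀ i : ZMod n, B.obj (i + 1) ⟶ B.obj i)
    (hfg : ∀ i, f.app i ≫ g.app i = 𝟙 _) (hfg' : ∀ i, f'.app i ≫ g'.app i = 𝟙 _)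
    (hf : ∀ i, f.app i ≫ φ.app i = φ'.app i ≫ f'.app i)
    (hg : ∀ i, φ.app i ≫ g'.app i = g.app i ≫ φ'.app i)
    (hh : ∀ i, A.map (i + 1) ≫ h (i + 1) + h i ≫ A.map i + φ.app (i + 1) ≫ s.app (i + 1) =
      𝟙 _ - g.app (i + 1) ≫ f.app (i + 1))
    (hh' : ∀ i, B.map (i + 1) ≫ h' (i + 1) + h' i ≫ B.map i + s.app (i + 1) ≫ φ.app (i + 1) =
      𝟙 _ - g'.app (i + 1) ≫ f'.app (i + 1))
    (hφ : ∀ i, φ.app (i + 1) ≫ h' i = h i ≫ φ.app i)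
    (hfh : ∀ i, f.app (i + 1) ≫ h i = 0) (hhg : ∀ i, h i ≫ g.app i = 0)
    (hfh' : ∀ i, f'.app (i + 1) ≫ h' i = 0) (hhg' : ∀ i, h' i ≫ g'.app i = 0)
    (hfs : ∀ i, f'.app i ≫ s.app i = 0) (hsg : ∀ i, s.app i ≫ g.app i = 0) :
    Reduction (cone φ') (cone φ) where
  f :=
    { app := fun i => biprod.map (f.app (i + 1)) (f'.app i)
      comm := fun i => by
        dsimp +instances [NSigmaSeq.cone]
        ext <;> simp [f.comm, f'.comm, hf] }
  g :=
    { app := fun i => biprod.map (g.app (i + 1)) (g'.app i)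
      comm := fun i => by
        dsimp +instances [NSigmaSeq.cone]
        ext <;> simp [g.comm, g'.comm, hg] }
  -- The off-diagonal entry `s` contracts the part on which `φ` is invertible; `hh` and `hh'` say
  -- that it makes up exactly what `h` and `h'` fail to contract. The sign of `-h` matches that of
  -- the cone.
  h i := biprod.desc (biprod.lift (-h (i + 1)) 0) (biprod.lift (s.app (i + 1)) (h' i))
  f_g i := by
    dsimp +instances [NSigmaSeq.cone]
    ext <;> simp [hfg, hfg']
  homotopy i := by
    have h1 := hh (i + 1)
    have h2 := hh' i
    have h3 := hφ (i + 1)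
    have h4 := s.comm (i + 1)
    dsimp +instances [NSigmaSeq.cone]
    ext
    · simp [← h1]
      abel
    · simp [h3]
    · simp [h4]
    · simp [← h2]
      abel
  f_h i := by
    change biprod.map _ _ ≫ biprod.desc _ _ =
      (0 : A'.obj (i + 1 + 1) ⊞ B'.obj (i + 1) ⟶ A.obj (i + 1) ⊞ B.obj i)
    ext <;> simp [hfh, hfh', hfs]
  h_g i := by
    change biprod.desc _ _ ≫ biprod.map _ _ =
      (0 : A.obj (i + 1 + 1) ⊞ B.obj (i + 1) ⟶ A'.obj (i + 1) ⊞ B'.obj i)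
    ext <;> simp [hhg, hhg', hsg]

/-- The cone of the identity of the sequence with objects `Y` and zero maps. -/
noncomputable def coneId (Y : ZMod n → C) : NSigmaSeq C n where
  obj i := Y (i + 1) ⊞ Y i
  map _ := biprod.fst ≫ biprod.inr

theorem coneId_isCandidate (Y : ZMod n → C) : (coneId Y).IsCandidate := fun i => by
  change (biprod.fst ≫ biprod.inr) ≫ biprod.fst ≫ biprod.inr =
    (0 : Y (i + 1) ⊞ Y i ⟶ Y (i + 1 + 1 + 1) ⊞ Y (i + 1 + 1))
  simp

theorem coneId_isContractible (Y : ZMod n → C) : (coneId Y).IsContractible :=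
  ⟨fun _ => biprod.snd ≫ biprod.inl, fun i => by
    dsimp +instances [coneId, Hom.id, Hom.zero]
    ext <;> simp⟩

end Biproducts

end NSigmaSeq

/-! ### Linear categories that are regular modulo an element of square zero -/

/-- The scalar `p` has square zero, its annihilator on morphisms consists of the multiples of `p`,
every morphism is von Neumann regular modulo `p`, and idempotents split. -/
structure IsRegularMod {R : Type w} [CommRing R] (C : Type u) [Category.{v} C] [Preadditive C]
    [Linear R C] (p : R) : Prop where
  sq : p * p = 0
  exists_eq_smul : ∀ {X Y : C} (f : X ⟶ Y), p • f = 0 → ∃ g, f = p • g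
  exists_regular : ∀ {X Y : C} (α : X ⟶ Y), ∃ (h : Y ⟶ X) (β : X ⟶ Y), α - α ≫ h ≫ α = p • β
  split : ∀ {X : C} (e : X ⟶ X), e ≫ e = e → ∃ (P : C) (i : P ⟶ X) (r : X ⟶ P),
      i ≫ r = 𝟙 P ∧ r ≫ i = e

namespace IsRegularMod

variable {R : Type w} [CommRing R] {C : Type u} [Category.{v} C] [Preadditive C] [Linear R C]
  {p : R} (hC : IsRegularMod C p)

include hC

theorem smul_smul_eq_zero {X Y : C} (f : X ⟶ Y) : p • p • f = 0 := by
  rw [smul_smul, hC.sq, zero_smul]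

/-- Idempotents lift along a square-zero ideal; in this form it turns a quasi-inverse modulo `p`
into an exact outer inverse. -/
theorem exists_outer_inverse {X Y : C} (α : X ⟶ Y) :
    ∃ (h : Y ⟶ X) (β : X ⟶ Y), h ≫ α ≫ h = h ∧ α - α ≫ h ≫ α = p • β := by
  obtain ⟨h, β, hβ⟩ := hC.exists_regular α
  let x : End Y := h ≫ α
  have ht : (x * x - x) * (x * x - x) = 0 := by
    have h1 : x * x - x = (-p) • (h ≫ β : Y ⟶ Y) := by
      change (h ≫ α) ≫ (h ≫ α) - h ≫ α = _
      have : (h ≫ α) ≫ (h ≫ α) - h ≫ α = -(h ≫ (α - α ≫ h ≫ α)) := by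
        simp [Preadditive.comp_sub]
      rw [this, hβ, Linear.comp_smul, neg_smul]
    rw [h1]
    change ((-p) • (h ≫ β)) ≫ ((-p) • (h ≫ β)) = 0
    simp [hC.smul_smul_eq_zero]
  -- Here `e = 3x² - 2x³` is the standard idempotent near `x`, exact because `(x² - x)² = 0`.
  let q : End Y := 3 * x - 2 * (x * x)
  let e : End Y := q * x
  have he : e * e = e := by
    have : e * e - e = (x * x - x) * (x * x - x) * (4 * (x * x) - 4 * x - 3) := by
      dsimp only [e, q]
      noncomm_ring
    rw [ht, zero_mul] at this
    exact sub_eq_zero.mp this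
  have hxq : x * q = e := by
    dsimp only [e, q]
    noncomm_ring
  have hqx : (q : Y ⟶ Y) ≫ h ≫ α = e := hxq
  have hee : (e : Y ⟶ Y) ≫ e = e := he
  have hr : ((e : Y ⟶ Y) ≫ q ≫ h) ≫ α = e := by
    rw [Category.assoc, Category.assoc, hqx, hee]
  have hαx : α ≫ x = α - p • β := by
    rw [← hβ]
    simp [x]
  -- Followed by `α` the new inverse is `e` itself, hence the outer inverse law. The second witness
  -- comes from expanding `α ≫ e` with `α ≫ x = α - p β`.
  refine ⟨(e : Y ⟶ Y) ≫ q ≫ h, β + β ≫ x - (2 : ℤ) • β ≫ x ≫ x, ?_, ?_⟩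
  · rw [← Category.assoc, hr, ← Category.assoc, hee]
  · rw [hr]
    have he' : e = (3 : ℤ) • ((x : Y ⟶ Y) ≫ x) - (2 : ℤ) • ((x : Y ⟶ Y) ≫ x ≫ x) := by
      change e = (3 : ℤ) • (x * x) - (2 : ℤ) • ((x * x) * x)
      dsimp only [e, q]
      noncomm_ring
    have h2 : α ≫ (x : Y ⟶ Y) ≫ x = α - p • β - p • (β ≫ x) := by
      rw [← Category.assoc, hαx, Preadditive.sub_comp, hαx, Linear.smul_comp]
    have h3 : α ≫ (x : Y ⟶ Y) ≫ x ≫ x = α - p • β - p • (β ≫ x) - p • (β ≫ x ≫ x) := by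
      rw [← Category.assoc, hαx, Preadditive.sub_comp, h2, Linear.smul_comp]
    rw [he', Preadditive.comp_sub, Preadditive.comp_zsmul, Preadditive.comp_zsmul, h2, h3]
    module

/-- A morphism congruent to the identity modulo `p` is invertible. -/
theorem isIso_of_one_sub {X : C} (f z : X ⟶ X) (h : 𝟙 X - f = p • z) : IsIso f := by
  have hf : f = 𝟙 X - p • z := by rw [← h, sub_sub_cancel]
  refine ⟨𝟙 X + p • z, ?_, ?_⟩ <;>
  simp [hf, smul_sub, Preadditive.comp_add, Preadditive.add_comp, Preadditive.sub_comp, Preadditive.comp_sub,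
    hC.smul_smul_eq_zero]

/-- Every morphism is the direct sum of an identity and of a multiple of `p`. -/
theorem exists_decomposition [HasBinaryBiproducts C] {X Y : C} (α : X ⟶ Y) :
    ∃ (P X₀ Y₀ : C) (a : X ≅ P ⊞ X₀) (b : Y ≅ P ⊞ Y₀) (β : X₀ ⟶ Y₀),
      α ≫ b.hom = a.hom ≫ biprod.map (𝟙 P) (p • β) := by
  obtain ⟨h, β, hh, hβ⟩ := hC.exists_outer_inverse α
  -- `P` is the image of the idempotent `α ≫ h`, carried isomorphically to that of `h ≫ α`. On the
  -- complements `α` acts as `α - α ≫ h ≫ α = p β`.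
  obtain ⟨P, i, r, hir, hri⟩ := hC.split (α ≫ h) (by simp [hh])
  obtain ⟨X₀, i₀, r₀, hir₀, hri₀⟩ := hC.split (𝟙 X - α ≫ h) (by
    simp [Preadditive.comp_sub, Preadditive.sub_comp, hh])
  obtain ⟨Y₀, i₁, r₁, hir₁, hri₁⟩ := hC.split (𝟙 Y - h ≫ α) (by
    simp [Preadditive.comp_sub, Preadditive.sub_comp, reassoc_of% hh])
  have hi : i ≫ α ≫ h = i := by rw [← hri, reassoc_of% hir]
  have hr : α ≫ h ≫ r = r := by rw [← Category.assoc, ← hri, Category.assoc, hir, Category.comp_id]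
  have h1 : i₀ ≫ α ≫ h = 0 := by
    have : i₀ ≫ (𝟙 X - α ≫ h) = i₀ := by rw [← hri₀, reassoc_of% hir₀]
    simpa [Preadditive.comp_sub] using this
  have h2 : α ≫ h ≫ r₀ = 0 := by
    have : (𝟙 X - α ≫ h) ≫ r₀ = r₀ := by rw [← hri₀, Category.assoc, hir₀, Category.comp_id]
    simpa [Preadditive.sub_comp] using this
  have h3 : i₁ ≫ h ≫ α = 0 := by
    have : i₁ ≫ (𝟙 Y - h ≫ α) = i₁ := by rw [← hri₁, reassoc_of% hir₁]
    simpa [Preadditive.comp_sub] using this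
  have h4 : h ≫ α ≫ r₁ = 0 := by
    have : (𝟙 Y - h ≫ α) ≫ r₁ = r₁ := by rw [← hri₁, Category.assoc, hir₁, Category.comp_id]
    simpa [Preadditive.sub_comp] using this
  have h5 : i₁ ≫ h = 0 := by rw [← hh, reassoc_of% h3, zero_comp]
  have h6 : h ≫ r₀ = 0 := by rw [← hh, Category.assoc, Category.assoc, h2, comp_zero]
  have h7 : i ≫ α ≫ r₁ = 0 := by rw [← hi, Category.assoc, Category.assoc, h4, comp_zero, comp_zero]
  have h8 : i ≫ r₀ = 0 := by rw [← hi, Category.assoc, Category.assoc, h2, comp_zero]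
  have h9 : i₀ ≫ r = 0 := by rw [← hr, reassoc_of% h1, zero_comp]
  have hαr : α ≫ r₁ = r₀ ≫ i₀ ≫ α ≫ r₁ := by
    rw [reassoc_of% hri₀, Preadditive.sub_comp, Category.id_comp, Category.assoc, h4, comp_zero,
      sub_zero]
  have hiα : i₀ ≫ α ≫ r₁ = p • (i₀ ≫ β ≫ r₁) := by
    rw [← Linear.comp_smul, ← Linear.smul_comp, ← hβ]
    simp [Preadditive.sub_comp, h4]
  refine ⟨P, X₀, Y₀,
    ⟨biprod.lift r r₀, biprod.desc i i₀, ?_, ?_⟩,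
    ⟨biprod.lift (h ≫ r) r₁, biprod.desc (i ≫ α) i₁, ?_, ?_⟩, i₀ ≫ β ≫ r₁, ?_⟩
  · rw [biprod.lift_desc, hri, hri₀, add_sub_cancel]
  · ext <;> simp [hir, hir₀, h8, h9]
  · rw [biprod.lift_desc, hri₁, Category.assoc, reassoc_of% hri, reassoc_of% hh, add_sub_cancel]
  · ext <;> simp [hr, hir, hir₁, h7, reassoc_of% h5]
  · ext
    · simp [hr]
    · simp [← hiα, ← hαr]

end IsRegularMod

/-! ### Minimal reductions and the normal form of exact candidates -/

namespace NSigmaSeq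

variable {R : Type w} [CommRing R] {C : Type u} [Category.{v} C] [Preadditive C] [Linear R C]
  {n : ℕ} {p : R}

/-- A candidate sequence retracts onto a sequence all of whose maps are multiples of `p`. -/
theorem exists_minimal_reduction (hC : IsRegularMod C p) {A : NSigmaSeq C n}
    (hA : A.IsCandidate) :
    ∃ (G : NSigmaSeq C n) (γ : ∀ i, G.obj i ⟶ G.obj (i + 1)),
      (∀ i, G.map i = p • γ i) ∧ Nonempty (Reduction G A) := by
  have hx := fun i => hC.exists_outer_inverse (A.map i)
  choose k β hk hβ using hx
  -- The correcting factor makes consecutive homotopies compose to zero, using `k α k = k`, without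
  -- changing `α k α`.
  obtain ⟨h, hdef⟩ : ∃ h : ∀ i : ZMod n, A.obj (i + 1) ⟶ A.obj i,
      ∀ i, h i = (𝟙 _ - A.map (i + 1) ≫ k (i + 1)) ≫ k i := ⟨_, fun _ => rfl⟩
  have hhh : ∀ i, h (i + 1) ≫ h i = 0 := fun i => by
    simp only [hdef, Category.assoc, Preadditive.comp_sub, Preadditive.sub_comp, Category.id_comp,
      reassoc_of% (hk (i + 1))]
    simp
  have hhdh : ∀ i, h i ≫ A.map i ≫ h i = h i := fun i => by
    simp only [hdef, Category.assoc, Preadditive.comp_sub, Preadditive.sub_comp, Category.id_comp,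
      reassoc_of% (hA i), zero_comp, sub_zero, hk]
  have hdhd : ∀ i, A.map i ≫ h i ≫ A.map i = A.map i ≫ k i ≫ A.map i := fun i => by
    simp only [hdef, Category.assoc, Preadditive.comp_sub, Preadditive.sub_comp, Category.id_comp,
      reassoc_of% (hA i), zero_comp, sub_zero]
  -- Consequently `e = α h + h α` is an idempotent endomorphism of the sequence; the reduced
  -- sequence is the image of `1 - e`.
  obtain ⟨e, he⟩ := ZMod.exists_shift (P := fun j => (A.obj j ⟶ A.obj j))
    (fun i => A.map (i + 1) ≫ h (i + 1) + h i ≫ A.map i)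
  have hee : ∀ j, e j ≫ e j = e j := ZMod.forall_of_forall_succ fun i => by
    rw [he]
    simp only [Preadditive.comp_add, Preadditive.add_comp, Category.assoc,
      reassoc_of% (hhh i), reassoc_of% (hA i), zero_comp, comp_zero, hhdh, reassoc_of% (hhdh i)]
    simp
  have heα : ∀ j, e j ≫ A.map j = A.map j ≫ h j ≫ A.map j := ZMod.forall_of_forall_succ fun i => by
    rw [he]
    simp only [Preadditive.add_comp, Category.assoc, hA i, comp_zero, add_zero]
  have hαe : ∀ j, A.map j ≫ e (j + 1) = A.map j ≫ h j ≫ A.map j := fun i => by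
    rw [he]
    simp only [Preadditive.comp_add, reassoc_of% (hA i), zero_comp, zero_add]
  have heh : ∀ i, e (i + 1) ≫ h i = h i := fun i => by
    rw [he]
    simp only [Preadditive.add_comp, Category.assoc, hhh, comp_zero, zero_add, hhdh]
  have hhe : ∀ i, h i ≫ e i = h i := ZMod.forall_of_forall_succ fun i => by
    rw [he]
    simp only [Preadditive.comp_add, reassoc_of% (hhh i), zero_comp, add_zero, hhdh]
  have hx := fun j => hC.split (𝟙 _ - e j) (by
    simp [Preadditive.comp_sub, Preadditive.sub_comp, hee])
  choose G f g hfg hgf using hx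
  have hf : ∀ j, f j ≫ e j = 0 := fun j => by
    have : f j ≫ (𝟙 _ - e j) = f j := by rw [← hgf, reassoc_of% (hfg j)]
    simpa [Preadditive.comp_sub] using this
  have hg : ∀ j, e j ≫ g j = 0 := fun j => by
    have : (𝟙 _ - e j) ≫ g j = g j := by rw [← hgf, Category.assoc, hfg, Category.comp_id]
    simpa [Preadditive.sub_comp] using this
  refine ⟨⟨G, fun j => f j ≫ A.map j ≫ g (j + 1)⟩, fun j => f j ≫ β j ≫ g (j + 1), fun j => ?_,
    ⟨⟨⟨f, fun j => ?_⟩, ⟨g, fun j => ?_⟩, h, hfg, fun i => ?_, fun i => ?_, fun i => ?_⟩⟩⟩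
  -- On the image of `1 - e` the term `α k α = e α` vanishes, so the map is `α - α k α = p β` there.
  · change f j ≫ A.map j ≫ g (j + 1) = _
    rw [← Linear.comp_smul, ← Linear.smul_comp, ← hβ, ← hdhd, ← heα]
    simp [Preadditive.sub_comp, Preadditive.comp_sub, reassoc_of% (hf j)]
  · change (f j ≫ A.map j ≫ g (j + 1)) ≫ f (j + 1) = _
    rw [Category.assoc, Category.assoc, hgf, Preadditive.comp_sub, hαe, ← heα]
    simp [Preadditive.comp_sub, reassoc_of% (hf j)]
  · change _ = g j ≫ f j ≫ A.map j ≫ g (j + 1)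
    rw [reassoc_of% (hgf j), Preadditive.sub_comp, ← Category.assoc (e j), heα, ← hαe]
    simp [hg]
  · change _ = 𝟙 _ - g (i + 1) ≫ f (i + 1)
    rw [hgf, he, sub_sub_cancel]
  · change f (i + 1) ≫ h i = 0
    rw [← heh, reassoc_of% (hf (i + 1)), zero_comp]
  · change h i ≫ g i = 0
    rw [← hhe, Category.assoc, hg, comp_zero]

/-- In an exact sequence whose maps are multiples of `p` the cofactors are invertible. -/
theorem isIso_of_isExact (hC : IsRegularMod C p) {G : NSigmaSeq C n} (hG : G.IsExact)
    (γ : ∀ i, G.obj i ⟶ G.obj (i + 1)) (hγ : ∀ i, G.map i = p • γ i) (j : ZMod n) :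
    IsIso (γ j) := by
  -- Since `p² = 0`, `p · 1` is a cycle, hence `p = y ≫ p γ_i`. Then `1 - y ≫ γ_i` is killed by `p`,
  -- so it is a multiple of `p`, and `y ≫ γ_i` is invertible.
  have key : ∀ i, ∃ s, s ≫ γ i = 𝟙 _ := fun i => by
    obtain ⟨y, hy⟩ := hG i (p • 𝟙 (G.obj (i + 1))) (by
      rw [hγ, Linear.smul_comp, Linear.comp_smul, hC.smul_smul_eq_zero])
    have h1 : p • (𝟙 (G.obj (i + 1)) - y ≫ γ i) = 0 := by
      rw [smul_sub, hy, hγ, Linear.comp_smul, sub_self]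
    obtain ⟨z, hz⟩ := hC.exists_eq_smul _ h1
    have := hC.isIso_of_one_sub _ _ hz
    exact ⟨inv (y ≫ γ i) ≫ y, by rw [Category.assoc, IsIso.inv_hom_id]⟩
  revert j
  refine ZMod.forall_of_forall_succ fun i => ?_
  obtain ⟨s, hs⟩ := key (i + 1)
  -- `1 - γ ≫ s` is a cycle because `s ≫ γ = 1`, hence a boundary, hence a multiple of `p`. So the
  -- idempotent `γ ≫ s` is invertible and must be the identity.
  obtain ⟨y, hy⟩ := hG i (𝟙 _ - γ (i + 1) ≫ s) (by
    rw [hγ, Linear.comp_smul, Preadditive.sub_comp, Category.assoc, hs, Category.comp_id,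
      Category.id_comp, sub_self, smul_zero])
  rw [hγ, Linear.comp_smul] at hy
  have := hC.isIso_of_one_sub _ _ hy
  refine ⟨s ≫ inv (γ (i + 1) ≫ s) ≫ γ (i + 1) ≫ s, ?_, ?_⟩
  · rw [← Category.assoc, IsIso.hom_inv_id_assoc]
    have h2 : (γ (i + 1) ≫ s) ≫ γ (i + 1) ≫ s = γ (i + 1) ≫ s := by
      rw [Category.assoc, reassoc_of% hs]
    rwa [← cancel_epi (γ (i + 1) ≫ s), Category.comp_id]
  · rw [IsIso.inv_hom_id, Category.comp_id, hs]

/-- The sequence `F ⟶ F ⟶ ⋯ ⟶ F ⟶ F` with maps `p M, p, …, p`. -/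
def minSeq (n : ℕ) (p : R) {F : C} (M : F ⟶ F) : NSigmaSeq C n where
  obj _ := F
  map i := if i = 1 then p • M else p • 𝟙 F

theorem minSeq_map {F : C} (M : F ⟶ F) (i : ZMod n) :
    (minSeq n p M).map i = p • (if i = 1 then M else 𝟙 F) := by
  dsimp only [minSeq]
  split_ifs <;> rfl

/-- The normal form of exact candidates. -/
theorem exists_reduction_minSeq [NeZero n] (hC : IsRegularMod C p) {A : NSigmaSeq C n}
    (hA : A.IsCandidate) (hE : A.IsExact) :
    ∃ (F : C) (M : F ⟶ F), IsIso M ∧ Nonempty (Reduction (minSeq n p M) A) := by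
  obtain ⟨G, γ, hγ, ⟨r⟩⟩ := exists_minimal_reduction hC hA
  have hiso := isIso_of_isExact hC (r.isExact_left hE) γ hγ
  -- All objects are identified with the one at label `2` along the `γ_i`. Starting there leaves the
  -- only unabsorbed map at label `1`, where `minSeq` has its monodromy.
  obtain ⟨t, ht0, ht⟩ := ZMod.exists_section (P := fun i => G.obj (1 + 1) ≅ G.obj i) (1 + 1)
    (Iso.refl _) (fun i e => e ≪≫ asIso (γ i))
  have hts : ∀ i, i ≠ 1 → (t (i + 1)).hom = (t i).hom ≫ γ i := fun i hi => by
    rw [ht i (fun h => hi (add_right_cancel h))]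
    rfl
  refine ⟨G.obj (1 + 1), (t 1).hom ≫ γ 1 ≫ (t (1 + 1)).inv, inferInstance,
    ⟨r.ofIsoLeft ⟨fun i => (t i).hom, fun i => ?_⟩ fun i => (t i).isIso_hom⟩⟩
  rw [minSeq_map, hγ]
  dsimp only [minSeq]
  split_ifs with h
  · subst h
    simp
  · rw [hts i h]
    simp

/-! ### Invariance of the monodromy and the classes of fixed monodromy -/

section Transfer

variable {R : Type w} [CommRing R] {C : Type u} [Category.{v} C] [Preadditive C] [Linear R C]
  {n : ℕ} {p : R}

theorem minSeq_congr {F : C} {M M' : F ⟶ F} (h : p • M = p • M') :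
    minSeq n p M = minSeq n p M' := by
  simp only [minSeq, h]

theorem minSeq_isCandidate (hC : IsRegularMod C p) {F : C} (M : F ⟶ F) :
    (minSeq n p M).IsCandidate := fun i => by
  rw [minSeq_map, minSeq_map]
  change (p • (if i = 1 then M else 𝟙 F)) ≫ (p • (if i + 1 = 1 then M else 𝟙 F)) = (0 : F ⟶ F)
  rw [Linear.smul_comp, Linear.comp_smul, hC.smul_smul_eq_zero]

/-- Every map is `p` times an isomorphism, and a morphism killed by `p` is a multiple of `p`. -/
theorem minSeq_isExact (hC : IsRegularMod C p) {F : C} (M : F ⟶ F) [IsIso M] :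
    (minSeq n p M).IsExact := by
  intro i X x hx
  change X ⟶ F at x
  rw [minSeq_map] at hx
  have : IsIso (if i + 1 = 1 then M else 𝟙 F) := by split_ifs <;> infer_instance
  have hx' : x ≫ (p • (if i + 1 = 1 then M else 𝟙 F)) = 0 := hx
  rw [Linear.comp_smul, ← Linear.smul_comp, ← zero_comp, cancel_mono] at hx'
  obtain ⟨y, hy⟩ := hC.exists_eq_smul x hx'
  have : IsIso (if i = 1 then M else 𝟙 F) := by split_ifs <;> infer_instance
  obtain ⟨z, hz⟩ : ∃ z, z ≫ (if i = 1 then M else 𝟙 F) = y :=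
    ⟨y ≫ inv (if i = 1 then M else 𝟙 F), by simp⟩
  refine ⟨z, ?_⟩
  rw [minSeq_map]
  change x = z ≫ (p • (if i = 1 then M else 𝟙 F))
  rw [Linear.comp_smul, hz, hy]

theorem minSeq_isCoexact (hC : IsRegularMod C p) {F : C} (M : F ⟶ F) [IsIso M] :
    (minSeq n p M).IsCoexact := by
  intro i X x hx
  change F ⟶ X at x
  rw [minSeq_map] at hx
  have : IsIso (if i = 1 then M else 𝟙 F) := by split_ifs <;> infer_instance
  have hx' : (p • (if i = 1 then M else 𝟙 F)) ≫ x = 0 := hx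
  rw [Linear.smul_comp, ← Linear.comp_smul, ← comp_zero, cancel_epi] at hx'
  obtain ⟨y, hy⟩ := hC.exists_eq_smul x hx'
  have : IsIso (if i + 1 = 1 then M else 𝟙 F) := by split_ifs <;> infer_instance
  obtain ⟨z, hz⟩ : ∃ z, (if i + 1 = 1 then M else 𝟙 F) ≫ z = y :=
    ⟨inv (if i + 1 = 1 then M else 𝟙 F) ≫ y, by simp⟩
  refine ⟨z, ?_⟩
  rw [minSeq_map]
  change x = (p • (if i + 1 = 1 then M else 𝟙 F)) ≫ z
  rw [Linear.smul_comp, hz, hy]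

/-- With `smul_comp_minSeq_map` below, this is how homotopy terms disappear after multiplication by
`p`. -/
theorem smul_minSeq_map_comp (hC : IsRegularMod C p) {F X : C} (M : F ⟶ F) (i : ZMod n)
    (x : F ⟶ X) : p • ((minSeq n p M).map i ≫ x : (minSeq n p M).obj i ⟶ X) = 0 := by
  rw [minSeq_map]
  change p • ((p • (if i = 1 then M else 𝟙 F)) ≫ x) = 0
  rw [Linear.smul_comp, hC.smul_smul_eq_zero]

theorem smul_comp_minSeq_map (hC : IsRegularMod C p) {F X : C} (M : F ⟶ F) (i : ZMod n)
    (x : X ⟶ (minSeq n p M).obj i) : p • (x ≫ (minSeq n p M).map i) = 0 := by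
  change X ⟶ F at x
  rw [minSeq_map]
  change p • (x ≫ (p • (if i = 1 then M else 𝟙 F))) = 0
  rw [Linear.comp_smul, hC.smul_smul_eq_zero]

/-- The components of a morphism between minimal sequences agree modulo `p`. -/
theorem smul_app_minSeq [NeZero n] {F F' : C} {M : F ⟶ F} {M' : F' ⟶ F'}
    (ψ : Hom (minSeq n p M) (minSeq n p M')) (x : F ⟶ F') (hx : ψ.app 1 = x) :
    (∀ i, p • (ψ.app i : F ⟶ F') = p • x) ∧ p • (M ≫ x) = p • (x ≫ M') := by
  obtain ⟨s, hs⟩ : ∃ s : ZMod n → (F ⟶ F'), s = ψ.app := ⟨_, rfl⟩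
  have hcomm : ∀ i, p • ((if i = 1 then M else 𝟙 F) ≫ s (i + 1)) =
      p • (s i ≫ (if i = 1 then M' else 𝟙 F')) := fun i => by
    have := ψ.comm i
    rw [minSeq_map, minSeq_map, ← hs] at this
    rw [← Linear.smul_comp, ← Linear.comp_smul]
    exact this
  -- Every square other than the one at label `1` has only `p` as horizontal maps, so it propagates
  -- `p • s i`. The remaining square gives the relation between `M` and `M'`.
  have h2 : ∀ i, p • s i = p • s (1 + 1) :=
    ZMod.cyclic_induction (1 + 1) rfl fun i hi => by
      by_cases h : i = 1
      · rw [h]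
      · rw [← hi]
        simpa [h] using hcomm i
  have h3 : s 1 = x := by rw [hs, hx]
  have h4 : ∀ i, p • s i = p • x := fun i => by rw [← h3, h2, h2 1]
  refine ⟨fun i => ?_, ?_⟩
  · rw [← h4 i, hs]
    rfl
  · have := hcomm 1
    rw [if_pos rfl, if_pos rfl, h3, ← Linear.comp_smul, h4] at this
    rw [← this, Linear.comp_smul]

/-- An endomorphism which factors through a sequence with monodromy `u` is compatible
with the scalar `u`. -/
theorem smul_comp_of_factor [NeZero n] (hC : IsRegularMod C p) {A B : NSigmaSeq C n} {F F' : C}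
    {M : F ⟶ F} {u : R} (r : Reduction (minSeq n p M) A)
    (s : Reduction (minSeq n p (u • 𝟙 F')) B) (φ : Hom A B) (ψ : Hom B A) (x : F ⟶ F)
    (hx : x = r.f.app 1 ≫ φ.app 1 ≫ ψ.app 1 ≫ r.g.app 1) :
    p • (M ≫ x) = p • (x ≫ (u • 𝟙 F)) := by
  obtain ⟨c, hc⟩ : ∃ c : F ⟶ F', c = r.f.app 1 ≫ φ.app 1 ≫ s.g.app 1 := ⟨_, rfl⟩
  obtain ⟨d, hd⟩ : ∃ d : F' ⟶ F, d = s.f.app 1 ≫ ψ.app 1 ≫ r.g.app 1 := ⟨_, rfl⟩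
  have h1 := (smul_app_minSeq (r.f.comp (φ.comp s.g)) c hc.symm).2
  -- The identity of `B` differs from projecting to its minimal part and back by terms containing a
  -- map of `B`. Such a map slides past the morphisms to a map of the minimal sequence of `A`, where
  -- `p` kills it.
  have key : ∀ j, p • ((r.f.app j ≫ φ.app j ≫ s.g.app j) ≫ (s.f.app j ≫ ψ.app j ≫ r.g.app j) :
      (minSeq n p M).obj j ⟶ (minSeq n p M).obj j) =
      p • (r.f.app j ≫ φ.app j ≫ ψ.app j ≫ r.g.app j) := by
    refine ZMod.forall_of_forall_succ fun i => ?_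
    have h := congrArg (fun t => r.f.app (i + 1) ≫ φ.app (i + 1) ≫ t ≫ ψ.app (i + 1) ≫
      r.g.app (i + 1)) (s.id_eq i)
    simp only [Category.id_comp, Preadditive.add_comp, Preadditive.comp_add, Category.assoc] at h
    rw [h, smul_add, smul_add]
    have h2 : p • (r.f.app (i + 1) ≫ φ.app (i + 1) ≫ B.map (i + 1) ≫ s.h (i + 1) ≫
        ψ.app (i + 1) ≫ r.g.app (i + 1)) = 0 := by
      rw [← φ.comm_assoc, ← r.f.comm_assoc]
      exact smul_minSeq_map_comp hC M _ _
    have h3 : p • (r.f.app (i + 1) ≫ φ.app (i + 1) ≫ s.h i ≫ B.map i ≫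
        ψ.app (i + 1) ≫ r.g.app (i + 1)) = 0 := by
      rw [ψ.comm_assoc, r.g.comm]
      simpa only [Category.assoc] using smul_comp_minSeq_map hC M i
        (r.f.app (i + 1) ≫ φ.app (i + 1) ≫ s.h i ≫ ψ.app i ≫ r.g.app i)
    rw [h2, h3, zero_add, zero_add]
    simp only [Category.assoc]
  have h2 : p • (c ≫ d) = p • x := by
    rw [hc, hd, hx]
    exact key 1
  calc p • (M ≫ x) = M ≫ (p • (c ≫ d)) := by rw [h2, Linear.comp_smul]
    _ = (p • (M ≫ c)) ≫ d := by simp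
    _ = u • p • (c ≫ d) := by
      rw [h1]
      simp [smul_comm u p]
    _ = p • (x ≫ (u • 𝟙 F)) := by
      rw [h2]
      simp [smul_comm u p]

variable (n p) in
/-- The sequences with monodromy `u`. -/
def monodromyClass (u : R) : Set (NSigmaSeq C n) :=
  {A | A.IsCandidate ∧ ∃ F : C, Nonempty (Reduction (minSeq n p (u • 𝟙 F)) A)}

instance isIso_units_smul_id (u : Rˣ) (F : C) : IsIso ((u : R) • 𝟙 F) :=
  ⟨((u⁻¹ : Rˣ) : R) • 𝟙 F, by simp [smul_smul], by simp [smul_smul]⟩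

variable {u : Rˣ}

theorem isExact_of_mem (hC : IsRegularMod C p) {A : NSigmaSeq C n}
    (hA : A ∈ monodromyClass n p (u : R)) : A.IsExact := by
  obtain ⟨_, F, ⟨r⟩⟩ := hA
  exact r.isExact (minSeq_isExact hC _)

theorem isCoexact_of_mem (hC : IsRegularMod C p) {A : NSigmaSeq C n}
    (hA : A ∈ monodromyClass n p (u : R)) : A.IsCoexact := by
  obtain ⟨_, F, ⟨r⟩⟩ := hA
  exact r.isCoexact (minSeq_isCoexact hC _)

/-- Uniqueness of the monodromy. -/
theorem smul_eq_of_mem [NeZero n] (hC : IsRegularMod C p) {A : NSigmaSeq C n} {F : C}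
    {M : F ⟶ F} {v : R} (r : Reduction (minSeq n p M) A) (hA : A ∈ monodromyClass n p v) :
    p • M = p • v • 𝟙 F := by
  obtain ⟨_, F', ⟨s⟩⟩ := hA
  have := smul_comp_of_factor hC r s (Hom.id A) (Hom.id A) (𝟙 F) (by
    dsimp only [Hom.id]
    rw [Category.id_comp, Category.id_comp]
    exact (r.f_g 1).symm)
  simpa using this

/-- A sequence whose identity factors through two sequences with monodromy `u` has monodromy `u`. -/
theorem mem_of_sum [NeZero n] (hC : IsRegularMod C p) {A B B' : NSigmaSeq C n}
    (hA : A.IsCandidate) (hE : A.IsExact) (hB : B ∈ monodromyClass n p (u : R))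
    (hB' : B' ∈ monodromyClass n p (u : R)) (φ : Hom A B) (ψ : Hom B A) (φ' : Hom A B')
    (ψ' : Hom B' A) (h : φ.app 1 ≫ ψ.app 1 + φ'.app 1 ≫ ψ'.app 1 = 𝟙 _) :
    A ∈ monodromyClass n p (u : R) := by
  obtain ⟨F, M, hM, ⟨r⟩⟩ := exists_reduction_minSeq hC hA hE
  obtain ⟨_, F₁, ⟨s⟩⟩ := hB
  obtain ⟨_, F₂, ⟨s'⟩⟩ := hB'
  obtain ⟨x, hx⟩ : ∃ x : F ⟶ F, x = r.f.app 1 ≫ φ.app 1 ≫ ψ.app 1 ≫ r.g.app 1 := ⟨_, rfl⟩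
  obtain ⟨y, hy⟩ : ∃ y : F ⟶ F, y = r.f.app 1 ≫ φ'.app 1 ≫ ψ'.app 1 ≫ r.g.app 1 := ⟨_, rfl⟩
  have h1 := smul_comp_of_factor hC r s φ ψ x hx
  have h2 := smul_comp_of_factor hC r s' φ' ψ' y hy
  -- Each of `x` and `y` intertwines `M` with `u` after multiplication by `p`; their sum is the
  -- identity, so `p M = p u`.
  have h3 : 𝟙 F = x + y := by
    rw [hx, hy]
    have h4 := congrArg (fun t => r.f.app 1 ≫ t ≫ r.g.app 1) h
    simp only [Preadditive.add_comp, Preadditive.comp_add, Category.assoc, Category.id_comp,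
      r.f_g] at h4
    exact h4.symm
  have h4 : p • M = p • (u : R) • 𝟙 F := by
    have h5 : p • (M ≫ (x + y)) = p • ((x + y) ≫ ((u : R) • 𝟙 F)) := by
      rw [Preadditive.comp_add, Preadditive.add_comp, smul_add, smul_add, h1, h2]
    rwa [← h3, Category.comp_id, Category.id_comp] at h5
  exact ⟨hA, F, ⟨by rw [← minSeq_congr h4]; exact r⟩⟩

theorem mem_of_iso {A B : NSigmaSeq C n} (h : Isomorphic A B) {v : R}
    (hA : A ∈ monodromyClass n p v) : B ∈ monodromyClass n p v := by
  obtain ⟨hA, F, ⟨r⟩⟩ := hA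
  refine ⟨hA.of_iso h, F, ?_⟩
  obtain ⟨φ, hφ⟩ := h
  exact ⟨r.ofIso φ hφ⟩

/-- A contraction is a reduction onto the minimal sequence of the zero object. -/
theorem mem_of_isContractible [HasZeroObject C] {K : NSigmaSeq C n} (hK : K.IsCandidate)
    (h : K.IsContractible) {v : R} : K ∈ monodromyClass n p v := by
  obtain ⟨Θ, hΘ⟩ := h
  open scoped ZeroObject in
  refine ⟨hK, 0, ⟨⟨⟨fun i => (0 : (0 : C) ⟶ _), fun i => ?_⟩, ⟨fun i => (0 : _ ⟶ (0 : C)),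
    fun i => ?_⟩, Θ, fun i => ?_, fun i => ?_, fun i => ?_, fun i => ?_⟩⟩⟩
  · exact (isZero_zero C).eq_of_src _ _
  · exact (isZero_zero C).eq_of_tgt _ _
  · exact (isZero_zero C).eq_of_tgt _ _
  · rw [← hΘ]
    change 𝟙 _ - 0 = 𝟙 _ - (0 : K.obj (i + 1) ⟶ (0 : C)) ≫ 0
    simp
  · exact zero_comp
  · exact comp_zero

variable [HasBinaryBiproducts C]

theorem directSum_mem [NeZero n] (hC : IsRegularMod C p) {A B : NSigmaSeq C n}
    (hA : A ∈ monodromyClass n p (u : R)) (hB : B ∈ monodromyClass n p (u : R)) :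
    A.directSum B ∈ monodromyClass n p (u : R) :=
  mem_of_sum hC (hA.1.directSum hB.1) ((isExact_of_mem hC hA).directSum (isExact_of_mem hC hB))
    hA hB (Hom.fst A B) (Hom.inl A B) (Hom.snd A B) (Hom.inr A B) biprod.total

/-- The identity of a summand factors through the sum; the second term in `mem_of_sum` is taken to
be zero. -/
theorem of_directSum_mem [NeZero n] (hC : IsRegularMod C p) {A B : NSigmaSeq C n}
    (h : A.directSum B ∈ monodromyClass n p (u : R)) : A ∈ monodromyClass n p (u : R) :=
  mem_of_sum hC h.1.of_directSum (isExact_of_mem hC h).of_directSum h h (Hom.inl A B)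
    (Hom.fst A B) (Hom.zero _ _) (Hom.zero _ _) (by
      change biprod.inl ≫ biprod.fst + (0 : A.obj 1 ⟶ A.obj 1 ⊞ B.obj 1) ≫
        (0 : A.obj 1 ⊞ B.obj 1 ⟶ A.obj 1) = 𝟙 _
      simp)

end Transfer

/-! ### Trivial sequences -/

section Trivial

variable {C : Type u} [Category.{v} C] [Preadditive C] {n : ℕ}

/-- Only two adjacent objects can be nonzero, so for `n ≥ 3` any three consecutive ones include a
zero object. -/
theorem IsTrivialOn.isCandidate (hn : 3 ≤ n) {T : NSigmaSeq C n} {X : C} (h : T.IsTrivialOn X) :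
    T.IsCandidate := by
  intro i
  have h1 := ZMod.one_ne_zero_of_three_le hn
  have h2 := ZMod.one_add_one_ne_zero_of_three_le hn
  by_cases hi : i + 1 = 1
  · have h0 : i = 0 := by simpa using hi
    exact (h.2 i (by rw [h0]; exact h1.symm) (by rw [h0]; exact h2.symm)).eq_of_src _ _
  by_cases hi' : i + 1 = 1 + 1
  · refine (h.2 (i + 1 + 1) ?_ ?_).eq_of_tgt _ _
    · rw [hi']
      intro h'
      apply h2
      rwa [add_assoc, add_eq_left] at h'
    · rw [hi']
      simpa using h1
  · exact ((h.2 (i + 1) hi hi').eq_of_tgt (T.map i) 0).symm ▸ zero_comp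

theorem IsTrivialOn.isContractible (hn : 3 ≤ n) {T : NSigmaSeq C n} {X : C}
    (h : T.IsTrivialOn X) : T.IsContractible := by
  have h1 := ZMod.one_ne_zero_of_three_le hn
  obtain ⟨⟨e, f, hef⟩, hz⟩ := h
  have hiso : ∀ j, j = 1 → IsIso (T.map j) := by
    rintro j rfl
    have : T.map 1 = e.hom ≫ f.inv := by rw [← hef, Category.assoc, f.hom_inv_id, Category.comp_id]
    rw [this]
    infer_instance
  classical
  refine ⟨fun i => if hi : i = 1 then haveI := hiso i hi; inv (T.map i) else 0, fun i => ?_⟩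
  simp only [Hom.id, Hom.zero, sub_zero]
  by_cases hi : i + 1 = 1
  · have hi' : i ≠ 1 := by
      rintro rfl
      simp [h1] at hi
    have := hiso _ hi
    rw [dif_pos hi, dif_neg hi']
    simp
  by_cases hi' : i = 1
  · have := hiso i hi'
    rw [dif_neg hi, dif_pos hi']
    simp
  · exact (hz (i + 1) hi (by simpa using hi')).eq_of_src _ _

end Trivial

/-! ### Rotation -/

section Rotation

variable {C : Type u} [Category.{v} C] [Preadditive C] {n : ℕ}

/-- The sign of the `i`-th map of the left rotation. -/
def rotSign (i : ZMod n) : ℤ := if i = 0 then (-1) ^ n else 1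

theorem rotSign_mul_self (i : ZMod n) : rotSign i * rotSign i = 1 := by
  unfold rotSign
  split_ifs
  · rw [← pow_add, ← two_mul, pow_mul]
    simp
  · simp

theorem rotSign_smul_smul {X Y : C} (i : ZMod n) (f : X ⟶ Y) :
    rotSign i • rotSign i • f = f := by
  rw [smul_smul, rotSign_mul_self, one_smul]

theorem leftRotation_map (A : NSigmaSeq C n) (i : ZMod n) :
    A.leftRotation.map i = rotSign i • A.map (i + 1) := by
  dsimp only [leftRotation, rotSign]
  split_ifs
  · rfl
  · exact (one_smul _ _).symm

theorem rotSign_smul_eq_zero {X Y : C} {i : ZMod n} {f : X ⟶ Y} (h : rotSign i • f = 0) :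
    f = 0 := by
  rw [← rotSign_smul_smul i f, h, smul_zero]

theorem leftRotation_isCandidate_iff (A : NSigmaSeq C n) :
    A.leftRotation.IsCandidate ↔ A.IsCandidate := by
  have key : ∀ i, A.leftRotation.map i ≫ A.leftRotation.map (i + 1) = 0 ↔
      A.map (i + 1) ≫ A.map (i + 1 + 1) = 0 := fun i => by
    rw [leftRotation_map, leftRotation_map]
    change (rotSign i • A.map (i + 1)) ≫ (rotSign (i + 1) • A.map (i + 1 + 1)) = 0 ↔ _
    rw [Preadditive.zsmul_comp, Preadditive.comp_zsmul]
    refine ⟨fun h => rotSign_smul_eq_zero (rotSign_smul_eq_zero h), fun h => ?_⟩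
    rw [h, smul_zero, smul_zero]
  exact ⟨fun h => ZMod.forall_of_forall_succ fun i => (key i).1 (h i),
    fun h i => (key i).2 (h (i + 1))⟩

theorem IsExact.of_leftRotation {A : NSigmaSeq C n} (h : A.leftRotation.IsExact) : A.IsExact := by
  refine ZMod.forall_of_forall_succ fun i X x hx => ?_
  obtain ⟨y, hy⟩ := h i x (by
    rw [leftRotation_map]
    change x ≫ (rotSign (i + 1) • A.map (i + 1 + 1)) = 0
    rw [Preadditive.comp_zsmul, hx, smul_zero])
  change X ⟶ A.obj (i + 1) at y
  refine ⟨rotSign i • y, ?_⟩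
  rw [hy, leftRotation_map]
  change y ≫ (rotSign i • A.map (i + 1)) = _
  rw [Preadditive.comp_zsmul, Preadditive.zsmul_comp]

/-- The left rotation of a morphism. -/
def Hom.rotate {A B : NSigmaSeq C n} (φ : Hom A B) : Hom A.leftRotation B.leftRotation where
  app i := φ.app (i + 1)
  comm i := by
    rw [leftRotation_map, leftRotation_map]
    change (rotSign i • A.map (i + 1)) ≫ φ.app (i + 1 + 1) =
      φ.app (i + 1) ≫ (rotSign i • B.map (i + 1))
    rw [Preadditive.zsmul_comp, Preadditive.comp_zsmul, φ.comm]

/-- The left rotation of a reduction. -/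
def Reduction.rotate {G A : NSigmaSeq C n} (r : Reduction G A) :
    Reduction G.leftRotation A.leftRotation where
  f := r.f.rotate
  g := r.g.rotate
  h i := rotSign i • r.h (i + 1)
  f_g i := r.f_g (i + 1)
  homotopy i := by
    rw [leftRotation_map, leftRotation_map]
    have h := r.homotopy (i + 1)
    refine Eq.trans ?_ h
    change (rotSign (i + 1) • A.map (i + 1 + 1)) ≫ (rotSign (i + 1) • r.h (i + 1 + 1)) +
      (rotSign i • r.h (i + 1)) ≫ (rotSign i • A.map (i + 1)) = _
    rw [Preadditive.zsmul_comp, Preadditive.comp_zsmul, rotSign_smul_smul, Preadditive.zsmul_comp,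
      Preadditive.comp_zsmul, rotSign_smul_smul]
  f_h i := by
    change r.f.app (i + 1 + 1) ≫ (rotSign i • r.h (i + 1)) = 0
    rw [Preadditive.comp_zsmul, r.f_h, smul_zero]
  h_g i := by
    change (rotSign i • r.h (i + 1)) ≫ r.g.app (i + 1) = 0
    rw [Preadditive.zsmul_comp, r.h_g, smul_zero]

variable {R : Type w} [CommRing R] [Linear R C] {p : R}

/-- Rotating a minimal sequence multiplies its monodromy by `(-1) ^ n`. -/
noncomputable def Reduction.rotateMinSeq (hn : 3 ≤ n) {F : C} {M : F ⟶ F} [IsIso M]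
    {A : NSigmaSeq C n} (r : Reduction (minSeq n p M) A) :
    Reduction (minSeq n p (((-1) ^ n : ℤ) • M)) A.leftRotation :=
  r.rotate.ofIsoLeft
    -- After rotation the monodromy, with its sign, sits at label `0`; this component at label `1`
    -- moves it back to the first map.
    { app := fun i => (if i = 1 then ((-1) ^ n : ℤ) • M else 𝟙 F : F ⟶ F)
      comm := fun i => by
        rw [leftRotation_map, minSeq_map, minSeq_map]
        change (p • (if i = 1 then ((-1) ^ n : ℤ) • M else 𝟙 F)) ≫
            (if i + 1 = 1 then ((-1) ^ n : ℤ) • M else 𝟙 F : F ⟶ F) =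
          (if i = 1 then ((-1) ^ n : ℤ) • M else 𝟙 F) ≫
            (rotSign i • (p • (if i + 1 = 1 then M else 𝟙 F)) : F ⟶ F)
        have h1 := ZMod.one_ne_zero_of_three_le hn
        unfold rotSign
        by_cases h0 : i = 0
        · subst h0
          simp [h1.symm]
        · by_cases h : i = 1
          · subst h
            simp [h1]
          · simp [h, h0] }
    fun i => by
      change IsIso (if i = 1 then ((-1) ^ n : ℤ) • M else 𝟙 F : F ⟶ F)
      split_ifs
      · rcases Int.isUnit_iff.mp ((Int.isUnit_iff.mpr (Or.inr rfl)).pow n : IsUnit ((-1 : ℤ) ^ n))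
          with h | h <;> rw [h]
        · rw [one_smul]
          infer_instance
        · rw [neg_one_zsmul]
          exact ⟨-inv M, by simp, by simp⟩
      · infer_instance

/-- The sign `(-1)^n` picked up by the monodromy disappears after multiplication by `p` when `n` is
even or `2p = 0`. -/
theorem leftRotation_mem_iff (hn : 3 ≤ n) (hC : IsRegularMod C p)
    (hs : Even n ∨ 2 * p = 0) {u : Rˣ} (A : NSigmaSeq C n) :
    A ∈ monodromyClass n p (u : R) ↔ A.leftRotation ∈ monodromyClass n p (u : R) := by
  have : NeZero n := ⟨by omega⟩
  have hs' : ∀ {F : C} (M : F ⟶ F), p • ((-1) ^ n : ℤ) • M = p • M := fun {F} M => by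
    rcases hs with h | h
    · rw [h.neg_one_pow, one_smul]
    · rcases neg_one_pow_eq_or ℤ n with h' | h' <;> rw [h']
      · rw [one_smul]
      · rw [neg_one_zsmul, smul_neg, neg_eq_iff_add_eq_zero, ← add_smul, ← two_mul, h, zero_smul]
  constructor
  · rintro ⟨hA, F, ⟨r⟩⟩
    refine ⟨(leftRotation_isCandidate_iff A).2 hA, F, ⟨?_⟩⟩
    rw [← minSeq_congr (hs' ((u : R) • 𝟙 F))]
    exact r.rotateMinSeq hn
  · intro h
    have hA := (leftRotation_isCandidate_iff A).1 h.1
    -- No inverse rotation is needed: `A` has some monodromy `M`, and uniqueness applied to its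
    -- rotation gives `p M = p u`.
    obtain ⟨F, M, hM, ⟨r⟩⟩ := exists_reduction_minSeq hC hA (isExact_of_mem hC h).of_leftRotation
    have h1 := smul_eq_of_mem hC (r.rotateMinSeq hn) h
    rw [hs'] at h1
    exact ⟨hA, F, ⟨by rw [← minSeq_congr h1]; exact r⟩⟩

end Rotation

/-! ### Completing a morphism -/

/-! ### Realising a morphism as a first map -/

section FirstMap

variable {C : Type u} [Category.{v} C] [Preadditive C] [HasBinaryBiproducts C] [HasZeroObject C]
  {R : Type w} [CommRing R] [Linear R C] {n : ℕ} {p : R}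

/-- Every morphism is the first map of a sequence with monodromy `u`. -/
theorem exists_mem_first [NeZero n] (hn : 3 ≤ n) (hC : IsRegularMod C p) (u : Rˣ) {X Y : C}
    (α : X ⟶ Y) :
    ∃ A ∈ monodromyClass n p (u : R), ∃ (e : A.obj 1 ≅ X) (f : A.obj (1 + 1) ≅ Y),
      A.map 1 ≫ f.hom = e.hom ≫ α := by
  -- Decomposing twice and using `p² = 0` shows that `α` is `1_P ⊕ p 1_W ⊕ 0` with the zero map from
  -- `X₁` to `Y₁`.
  obtain ⟨P, X₀, Y₀, a, b, β, hα⟩ := hC.exists_decomposition α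
  obtain ⟨W, X₁, Y₁, a', b', γ, hβ⟩ := hC.exists_decomposition β
  have h1 := ZMod.one_ne_zero_of_three_le hn
  have h2 := ZMod.one_add_one_ne_zero_of_three_le hn
  -- The first map `Z_2 ⊞ Z_1 ⟶ Z_3 ⊞ Z_2` of `coneId Z` is the identity on `Z_2` and zero
  -- elsewhere, so it realises `1_P ⊕ 0`. The labels `1, 2, 3` are distinct because `n ≥ 3`.
  obtain ⟨Z, ⟨z₁⟩, ⟨z₂⟩, ⟨z₃⟩⟩ : ∃ Z : ZMod n → C, Nonempty (Z 1 ≅ X₁) ∧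
      Nonempty (Z (1 + 1) ≅ P) ∧ Nonempty (Z (1 + 1 + 1) ≅ Y₁) :=
    ⟨fun i => if i = 1 then X₁ else if i = 1 + 1 then P else Y₁,
      ⟨eqToIso (if_pos rfl)⟩,
      ⟨eqToIso ((if_neg (by simpa using h1)).trans (if_pos rfl))⟩,
      ⟨eqToIso ((if_neg (by rw [add_assoc, add_eq_left]; exact h2)).trans
        (if_neg (by simpa using h1)))⟩⟩
  refine ⟨(coneId Z).directSum (minSeq n p ((u : R) • 𝟙 W)),
    directSum_mem hC (mem_of_isContractible (coneId_isCandidate Z) (coneId_isContractible Z))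
      ⟨minSeq_isCandidate hC _, W, ⟨⟨Hom.id _, Hom.id _, fun _ => 0, fun i => ?_, fun i => ?_,
        fun i => comp_zero, fun i => zero_comp⟩⟩⟩, ?_⟩
  · exact Category.id_comp _
  · simp [Hom.id]
  -- The scalar `u` in `E` turns the first map `p u` of the minimal summand into `p`.
  let E : (Z (1 + 1) ⊞ Z 1) ⊞ W ≅ P ⊞ (W ⊞ X₁) :=
    { hom := biprod.desc (biprod.map z₂.hom (z₁.hom ≫ biprod.inr))
        (((u : R) • 𝟙 W) ≫ biprod.inl ≫ biprod.inr)
      inv := biprod.lift (biprod.map z₂.inv (biprod.snd ≫ z₁.inv))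
        (biprod.snd ≫ biprod.fst ≫ (((u⁻¹ : Rˣ) : R) • 𝟙 W))
      hom_inv_id := by
        ext <;> simp [smul_smul]
      inv_hom_id := by
        ext <;> simp [smul_smul] }
  let E' : (Z (1 + 1 + 1) ⊞ Z (1 + 1)) ⊞ W ≅ P ⊞ (W ⊞ Y₁) :=
    { hom := biprod.desc (biprod.desc (z₃.hom ≫ biprod.inr ≫ biprod.inr) (z₂.hom ≫ biprod.inl))
        (biprod.inl ≫ biprod.inr)
      inv := biprod.lift (biprod.lift (biprod.snd ≫ biprod.snd ≫ z₃.inv) (biprod.fst ≫ z₂.inv))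
        (biprod.snd ≫ biprod.fst)
      hom_inv_id := by
        ext <;> simp
      inv_hom_id := by
        ext <;> simp }
  have hE : biprod.map (biprod.fst ≫ biprod.inr) (p • (u : R) • 𝟙 W) ≫ E'.hom =
      E.hom ≫ biprod.map (𝟙 P) (biprod.map (p • 𝟙 W) 0) := by
    dsimp only [E, E']
    ext <;> simp [smul_comm p]
  have hβ' : p • β = a'.hom ≫ biprod.map (p • 𝟙 W) 0 ≫ b'.inv := by
    have h3 : β = a'.hom ≫ biprod.map (𝟙 W) (p • γ) ≫ b'.inv := by
      rw [← reassoc_of% hβ, b'.hom_inv_id, Category.comp_id]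
    have h4 : p • biprod.map (𝟙 W) (p • γ) = biprod.map (p • 𝟙 W) 0 := by
      ext <;> simp [hC.smul_smul_eq_zero]
    rw [h3, ← Linear.comp_smul, ← Linear.smul_comp, h4]
  have hα' : α = a.hom ≫ biprod.map (𝟙 P) (p • β) ≫ b.inv := by
    rw [← reassoc_of% hα, b.hom_inv_id, Category.comp_id]
  refine ⟨E ≪≫ biprod.mapIso (Iso.refl P) a'.symm ≪≫ a.symm,
    E' ≪≫ biprod.mapIso (Iso.refl P) b'.symm ≪≫ b.symm, ?_⟩
  change biprod.map (biprod.fst ≫ biprod.inr) ((minSeq n p ((u : R) • 𝟙 W)).map 1) ≫ _ = _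
  have hm : (minSeq n p ((u : R) • 𝟙 W)).map 1 = p • (u : R) • 𝟙 W := if_pos rfl
  rw [hm]
  change biprod.map (biprod.fst ≫ biprod.inr) (p • (u : R) • 𝟙 W) ≫
    E'.hom ≫ biprod.map (𝟙 P) b'.inv ≫ b.inv = (E.hom ≫ biprod.map (𝟙 P) a'.inv ≫ a.inv) ≫ α
  rw [reassoc_of% hE, hα', hβ']
  simp only [Category.assoc, Iso.inv_hom_id_assoc]
  congr 1
  simp only [← Category.assoc]
  congr 1
  ext <;> simp

end FirstMap

/-! ### Homotopies prescribing two components, and cones between minimal sequences -/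

section Completion

variable {C : Type u} [Category.{v} C] [Preadditive C] {n : ℕ}

/-- Adding a null-homotopic morphism. -/
theorem exists_hom_add_homotopy {A B : NSigmaSeq C n} (hA : A.IsCandidate) (hB : B.IsCandidate)
    (ψ : Hom A B) (Θ : ∀ i : ZMod n, A.obj (i + 1) ⟶ B.obj i) :
    ∃ φ : Hom A B, ∀ i,
      φ.app (i + 1) = ψ.app (i + 1) + (A.map (i + 1) ≫ Θ (i + 1) + Θ i ≫ B.map i) := by
  obtain ⟨s, hs⟩ := ZMod.exists_shift (P := fun j => (A.obj j ⟶ B.obj j))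
    (fun i => ψ.app (i + 1) + (A.map (i + 1) ≫ Θ (i + 1) + Θ i ≫ B.map i))
  refine ⟨⟨s, ZMod.forall_of_forall_succ fun i => ?_⟩, hs⟩
  rw [hs, hs]
  simp only [Preadditive.comp_add, Preadditive.add_comp, Category.assoc, ψ.comm,
    reassoc_of% (hA (i + 1)), hB i, zero_comp, comp_zero, zero_add, add_zero]

/-- A commutative square can be completed to a morphism homotopic to a given one, provided that
the latter has the correct effect on the reductions. -/
theorem exists_completion_homotopic (hn : 3 ≤ n) {A B G G' : NSigmaSeq C n} (hA : A.IsCandidate)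
    (hB : B.IsCandidate) (hA' : A.IsCoexact) (hB' : B.IsExact) (r : Reduction G A)
    (s : Reduction G' B) (ψ : Hom A B) (z : ZMod n) (φ₁ : A.obj (z + 1) ⟶ B.obj (z + 1))
    (φ₂ : A.obj (z + 1 + 1) ⟶ B.obj (z + 1 + 1))
    (hφ : A.map (z + 1) ≫ φ₂ = φ₁ ≫ B.map (z + 1))
    (hψ : ψ.app (z + 1) = r.g.app (z + 1) ≫ (r.f.app (z + 1) ≫ φ₁ ≫ s.g.app (z + 1)) ≫
      s.f.app (z + 1)) :
    ∃ (φ : Hom A B) (Θ : ∀ i : ZMod n, A.obj (i + 1) ⟶ B.obj i),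
      φ.app (z + 1) = φ₁ ∧ φ.app (z + 1 + 1) = φ₂ ∧
      ∀ i, φ.app (i + 1) = ψ.app (i + 1) + (A.map (i + 1) ≫ Θ (i + 1) + Θ i ≫ B.map i) := by
  have h1 := ZMod.one_ne_zero_of_three_le hn
  have h2 := ZMod.one_add_one_ne_zero_of_three_le hn
  -- Exactness of `B` gives a map `y` at label `z` completing the square before `φ₁`. Then `ψ₀` and
  -- `ψ₁` combine the contractions of source and target so that `φ₁ - ψ` is null-homotopic at label
  -- `z + 1`.
  obtain ⟨y, hy⟩ := hB' z (A.map z ≫ φ₁) (by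
    rw [Category.assoc, ← hφ, reassoc_of% (hA z), zero_comp])
  obtain ⟨ψ₀, hψ₀⟩ : ∃ x, x = φ₁ ≫ s.h z + r.h z ≫ y ≫ s.g.app z ≫ s.f.app z := ⟨_, rfl⟩
  obtain ⟨ψ₁, hψ₁⟩ : ∃ x, x = φ₂ ≫ s.h (z + 1) +
    r.h (z + 1) ≫ φ₁ ≫ s.g.app (z + 1) ≫ s.f.app (z + 1) := ⟨_, rfl⟩
  have e₁ : φ₁ = ψ.app (z + 1) + (A.map (z + 1) ≫ ψ₁ + ψ₀ ≫ B.map z) := by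
    have e := congrArg (fun t => φ₁ ≫ t) (s.id_eq z)
    have e' := congrArg (fun t => t ≫ φ₁ ≫ s.g.app (z + 1) ≫ s.f.app (z + 1)) (r.id_eq z)
    simp only [Category.comp_id, Category.id_comp, Preadditive.comp_add, Preadditive.add_comp,
      Category.assoc] at e e'
    have e₃ : y ≫ s.g.app z ≫ s.f.app z ≫ B.map z =
        A.map z ≫ φ₁ ≫ s.g.app (z + 1) ≫ s.f.app (z + 1) := by
      rw [← s.f.comm, ← s.g.comm_assoc, ← reassoc_of% hy]
    rw [hψ, hψ₁, hψ₀]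
    simp only [Preadditive.comp_add, Preadditive.add_comp, Category.assoc, e₃]
    rw [reassoc_of% hφ]
    refine e.trans ?_
    conv_lhs => rw [e']
    abel
  -- The remaining error at label `z + 2` vanishes on the preceding map of `A`, so coexactness
  -- factors it through the next one.
  obtain ⟨ψ₂, hψ₂⟩ := hA' (z + 1) (φ₂ - ψ.app (z + 1 + 1) - ψ₁ ≫ B.map (z + 1)) (by
    rw [Preadditive.comp_sub, Preadditive.comp_sub, hφ, ψ.comm, ← Category.assoc (A.map _),
      ← Preadditive.sub_comp, ← Preadditive.sub_comp]
    have : φ₁ - ψ.app (z + 1) - A.map (z + 1) ≫ ψ₁ = ψ₀ ≫ B.map z := by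
      rw [sub_sub, sub_eq_iff_eq_add]
      refine e₁.trans ?_
      abel
    rw [this, Category.assoc, hB z, comp_zero])
  obtain ⟨Θ, hΘ₀, hΘ₁, hΘ₂⟩ : ∃ Θ : ∀ i : ZMod n, A.obj (i + 1) ⟶ B.obj i,
      Θ z = ψ₀ ∧ Θ (z + 1) = ψ₁ ∧ Θ (z + 1 + 1) = ψ₂ := by
    classical
    refine ⟨Function.update (Function.update (Function.update 0 z ψ₀) (z + 1) ψ₁) (z + 1 + 1) ψ₂,
      ?_, ?_, ?_⟩
    · rw [Function.update_of_ne, Function.update_of_ne, Function.update_self]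
      · simpa using h1
      · rw [add_assoc]
        simpa using h2
    · rw [Function.update_of_ne, Function.update_self]
      simpa using h1
    · rw [Function.update_self]
  obtain ⟨φ, h⟩ := exists_hom_add_homotopy hA hB ψ Θ
  refine ⟨φ, Θ, ?_, ?_, h⟩
  · rw [h, hΘ₀, hΘ₁, ← e₁]
  · rw [h, hΘ₁, hΘ₂, ← hψ₂]
    abel

variable [HasBinaryBiproducts C]

/-- Removing from a mapping cone the contractible parts of source and target together with
the part on which the morphism is invertible. -/
noncomputable def Reduction.coneComp {A B G G' G₀ G₀' : NSigmaSeq C n} (r : Reduction G A)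
    (s : Reduction G' B) (χ : Hom G G') (k : Hom G' G) (χ' : Hom G₀ G₀') (i₀ : Hom G₀ G)
    (r₀ : Hom G G₀) (i₁ : Hom G₀' G') (r₁ : Hom G' G₀')
    (h₀ : ∀ i, i₀.app i ≫ r₀.app i = 𝟙 _) (h₁ : ∀ i, i₁.app i ≫ r₁.app i = 𝟙 _)
    (hi : ∀ i, i₀.app i ≫ χ.app i = χ'.app i ≫ i₁.app i)
    (hr : ∀ i, χ.app i ≫ r₁.app i = r₀.app i ≫ χ'.app i)
    (h₀' : ∀ i, r₀.app i ≫ i₀.app i = 𝟙 _ - χ.app i ≫ k.app i)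
    (h₁' : ∀ i, r₁.app i ≫ i₁.app i = 𝟙 _ - k.app i ≫ χ.app i)
    (hk : ∀ i, i₁.app i ≫ k.app i = 0) (hk' : ∀ i, k.app i ≫ r₀.app i = 0) :
    Reduction (NSigmaSeq.cone χ') (NSigmaSeq.cone (r.g.comp (χ.comp s.f))) :=
  Reduction.cone (r.g.comp (χ.comp s.f)) χ' (i₀.comp r.f) (r.g.comp r₀) (i₁.comp s.f)
    (s.g.comp r₁) (s.g.comp (k.comp r.f)) r.h s.h
    (fun i => by simp [Hom.comp, h₀]) (fun i => by simp [Hom.comp, h₁])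
    (fun i => by simp [Hom.comp, reassoc_of% (hi i)]) (fun i => by simp [Hom.comp, hr])
    (fun i => by
      simp only [Hom.comp, Category.assoc, s.f_g_assoc]
      rw [r.homotopy, reassoc_of% (h₀' (i + 1))]
      simp only [Preadditive.sub_comp, Preadditive.comp_sub, Category.id_comp, Category.assoc]
      abel)
    (fun i => by
      simp only [Hom.comp, Category.assoc, r.f_g_assoc]
      rw [s.homotopy, reassoc_of% (h₁' (i + 1))]
      simp only [Preadditive.sub_comp, Preadditive.comp_sub, Category.id_comp, Category.assoc]
      abel)
    (fun i => by simp [Hom.comp]) (fun i => by simp [Hom.comp]) (fun i => by simp [Hom.comp])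
    (fun i => by simp [Hom.comp]) (fun i => by simp [Hom.comp])
    (fun i => by simp [Hom.comp, reassoc_of% (hk i)]) (fun i => by simp [Hom.comp, hk'])

variable {R : Type w} [CommRing R] [Linear R C] {p : R}

/-- These signs undo the minus sign on the source part of a cone. Alternating signs close up around
an even cycle, and when `2p = 0` constant signs serve. -/
theorem exists_sign (hs : Even n ∨ 2 * p = 0) :
    ∃ σ : ZMod n → R, (∀ i, σ i * σ i = 1) ∧ ∀ i, p * σ (i + 1) = -(p * σ i) := by
  rcases hs with h | h
  · have hd : 2 ∣ n := h.two_dvd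
    refine ⟨fun i => if ZMod.castHom hd (ZMod 2) i = 0 then 1 else -1, fun i => ?_, fun i => ?_⟩
    · dsimp only
      split_ifs <;> simp
    · dsimp only
      rw [map_add, map_one]
      generalize ZMod.castHom hd (ZMod 2) i = x
      have : x = 0 ∨ x = 1 := by
        revert x
        decide
      rcases this with rfl | rfl
      · simp
      · rw [if_pos (by decide), if_neg (by decide)]
        simp
  · refine ⟨fun _ => 1, fun _ => one_mul _, fun _ => ?_⟩
    rw [mul_one, eq_neg_iff_add_eq_zero, ← two_mul, h]

/-- The `i`-th scalar of the sequence with monodromy `u`. -/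
def minScalar (u : R) (i : ZMod n) : R := if i = 1 then u else 1

theorem minSeq_smul_id_map (u : R) (F : C) (i : ZMod n) :
    (minSeq n p (u • 𝟙 F)).map i = (p * minScalar u i) • 𝟙 F := by
  rw [minSeq_map]
  dsimp only [minScalar]
  split_ifs
  · rw [smul_smul]
  · rw [mul_one]

theorem minScalar_mul_inv (u : Rˣ) (i : ZMod n) :
    minScalar (u : R) i * minScalar ((u⁻¹ : Rˣ) : R) i = 1 := by
  unfold minScalar
  split_ifs <;> simp

/-- The morphism between sequences of monodromy `u` given by a family constant modulo `p`. -/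
def minSeqHom {F F' : C} (u : R) (x : ZMod n → (F ⟶ F')) (hx : ∀ i, p • x (i + 1) = p • x i) :
    Hom (minSeq n p (u • 𝟙 F)) (minSeq n p (u • 𝟙 F')) where
  app := x
  comm i := by
    rw [minSeq_smul_id_map, minSeq_smul_id_map]
    change ((p * minScalar u i) • 𝟙 F) ≫ x (i + 1) = x i ≫ ((p * minScalar u i) • 𝟙 F')
    rw [Linear.smul_comp, Linear.comp_smul, Category.id_comp, Category.comp_id, mul_comm, mul_smul,
      hx, mul_smul]

/-- The mapping cone of a morphism all of whose components are multiples of `p` has monodromy `u`,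
after a suitable correction of a single component. -/
theorem exists_cone_iso [NeZero n] (hs : Even n ∨ 2 * p = 0) (u : Rˣ) {X Y : C} (c₀ : X ⟶ Y)
    (l : ZMod n) :
    ∃ c : X ⟶ Y, ∀ φ : Hom (minSeq n p ((u : R) • 𝟙 X)) (minSeq n p ((u : R) • 𝟙 Y)),
      (∀ i, φ.app i = p • (c₀ + if i = l then c else 0)) →
      Isomorphic (minSeq n p ((u : R) • 𝟙 (X ⊞ Y))) (cone φ) := by
  obtain ⟨σ, hσ, hσ'⟩ := exists_sign (n := n) hs
  -- The isomorphism is sought as a triangular matrix with off-diagonal entries `y i`. Commutation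
  -- asks for increments `σ i` times the component of the morphism, up to what `p` kills.
  obtain ⟨y, hy0, hy⟩ := ZMod.exists_section (P := fun _ => (X ⟶ Y)) l 0
    (fun i t => t + σ i • c₀)
  obtain ⟨m, hm⟩ : ∃ m, l = m + 1 := ⟨l - 1, (sub_add_cancel l 1).symm⟩
  -- This `c` makes the last increment, from `m` back to `l`, cancel the sum accumulated around the
  -- cycle, since `σ m * σ m = 1`.
  refine ⟨-c₀ - σ m • y m, fun φ hφ => ?_⟩
  have hys : ∀ i, y (i + 1) = y i + σ i • (c₀ + if i + 1 = l then -c₀ - σ m • y m else 0) := by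
    intro i
    by_cases h : i + 1 = l
    · have him : i = m := add_right_cancel (h.trans hm)
      subst him
      rw [if_pos h, h, hy0, add_sub, add_neg_cancel, zero_sub, smul_neg, smul_smul, hσ, one_smul,
        add_neg_cancel]
    · rw [hy i h, if_neg h, add_zero]
  generalize -c₀ - σ m • y m = c at hφ hys
  refine .of_inverse
    ⟨fun i => (biprod.desc (biprod.lift ((σ i * minScalar (u : R) i) • 𝟙 X) (y i)) biprod.inr :
      X ⊞ Y ⟶ X ⊞ Y), fun i => ?_⟩
    (fun i => (biprod.desc (biprod.lift ((σ i * minScalar ((u⁻¹ : Rˣ) : R) i) • 𝟙 X)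
      (-((σ i * minScalar ((u⁻¹ : Rˣ) : R) i) • y i))) biprod.inr : X ⊞ Y ⟶ X ⊞ Y))
    (fun i => ?_) (fun i => ?_)
  · rw [minSeq_smul_id_map]
    dsimp only [cone]
    rw [minSeq_smul_id_map, minSeq_smul_id_map, hφ]
    change ((p * minScalar (u : R) i) • 𝟙 (X ⊞ Y)) ≫
        (biprod.desc (biprod.lift ((σ (i + 1) * minScalar (u : R) (i + 1)) • 𝟙 X) (y (i + 1)))
          biprod.inr : X ⊞ Y ⟶ X ⊞ Y) =
      (biprod.desc (biprod.lift ((σ i * minScalar (u : R) i) • 𝟙 X) (y i)) biprod.inr :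
        X ⊞ Y ⟶ X ⊞ Y) ≫ biprod.desc
          (biprod.lift (-((p * minScalar (u : R) (i + 1)) • 𝟙 X))
            (p • (c₀ + if i + 1 = l then c else 0)))
          (biprod.lift 0 ((p * minScalar (u : R) i) • 𝟙 Y))
    have hp := hσ' i
    rw [hys]
    ext
    · simp only [Linear.smul_comp, Linear.comp_smul, Category.id_comp, Category.assoc,
        biprod.inl_desc, biprod.inl_desc_assoc, biprod.lift_fst, biprod.lift_desc,
        Preadditive.add_comp, comp_zero, add_zero, smul_smul, smul_neg]
      rw [← neg_smul]
      congr 1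
      linear_combination (minScalar (u : R) i * minScalar (u : R) (i + 1)) * hp
    · simp only [Linear.smul_comp, Linear.comp_smul, Category.id_comp, Category.comp_id,
        Category.assoc, biprod.inl_desc, biprod.inl_desc_assoc, biprod.lift_snd, biprod.lift_desc,
        Preadditive.add_comp, smul_smul, smul_add]
      module
    · simp
    · simp
  · change biprod.desc _ _ ≫ biprod.desc _ _ = 𝟙 (X ⊞ Y)
    have h : σ i * minScalar ((u⁻¹ : Rˣ) : R) i * (σ i * minScalar (u : R) i) = 1 := by
      linear_combination (σ i * σ i) * minScalar_mul_inv u i + hσ i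
    have h' := (mul_comm _ _).trans h
    ext <;> simp [smul_smul, h']
  · change biprod.desc _ _ ≫ biprod.desc _ _ = 𝟙 (X ⊞ Y)
    have h : σ i * minScalar ((u⁻¹ : Rˣ) : R) i * (σ i * minScalar (u : R) i) = 1 := by
      linear_combination (σ i * σ i) * minScalar_mul_inv u i + hσ i
    have h' := (mul_comm _ _).trans h
    ext <;> simp [smul_smul, h]

end Completion

/-! ### The classes of fixed monodromy are angulations -/

section Angulation

variable {C : Type u} [Category.{v} C] [Preadditive C] [HasBinaryBiproducts C] {n : ℕ}
  {R : Type w} [CommRing R] [Linear R C] {p : R}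

/-- A commutative square between sequences with monodromy `u` can be completed to a morphism whose
mapping cone has monodromy `u`. -/
theorem exists_completion_cone_mem (hn : 3 ≤ n) (hC : IsRegularMod C p)
    (hs : Even n ∨ 2 * p = 0) (u : Rˣ) {A B : NSigmaSeq C n}
    (hA : A ∈ monodromyClass n p (u : R)) (hB : B ∈ monodromyClass n p (u : R)) {j z : ZMod n}
    (hj : j = z + 1) (φ₁ : A.obj j ⟶ B.obj j) (φ₂ : A.obj (j + 1) ⟶ B.obj (j + 1))
    (hφ : A.map j ≫ φ₂ = φ₁ ≫ B.map j) :
    ∃ φ : Hom A B, φ.app j = φ₁ ∧ φ.app (j + 1) = φ₂ ∧ cone φ ∈ monodromyClass n p (u : R) := by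
  subst hj
  have : NeZero n := ⟨by omega⟩
  have h1 := ZMod.one_ne_zero_of_three_le hn
  have h2 := ZMod.one_add_one_ne_zero_of_three_le hn
  have hA' := isCoexact_of_mem hC hA
  have hB' := isExact_of_mem hC hB
  obtain ⟨hAc, F, ⟨r⟩⟩ := hA
  obtain ⟨hBc, F', ⟨s⟩⟩ := hB
  -- `χ` is the map induced by `φ₁` on minimal parts. Its quasi-inverse `k` splits off an invertible
  -- part, and the complementary part `i₀ ≫ χ ≫ r₁` is a multiple of `p`.
  obtain ⟨χ, hχ⟩ : ∃ χ : F ⟶ F', χ = r.f.app (z + 1) ≫ φ₁ ≫ s.g.app (z + 1) := ⟨_, rfl⟩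
  obtain ⟨k, β, hk, hβ⟩ := hC.exists_outer_inverse χ
  obtain ⟨X, i₀, r₀, hir₀, hri₀⟩ := hC.split (𝟙 F - χ ≫ k) (by
    simp [Preadditive.comp_sub, Preadditive.sub_comp, hk])
  obtain ⟨Y, i₁, r₁, hir₁, hri₁⟩ := hC.split (𝟙 F' - k ≫ χ) (by
    simp [Preadditive.comp_sub, Preadditive.sub_comp, reassoc_of% hk])
  have hi₀ : i₀ ≫ χ ≫ k = 0 := by
    have : i₀ ≫ (𝟙 F - χ ≫ k) = i₀ := by rw [← hri₀, reassoc_of% hir₀]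
    simpa [Preadditive.comp_sub] using this
  have hr₀ : χ ≫ k ≫ r₀ = 0 := by
    have : (𝟙 F - χ ≫ k) ≫ r₀ = r₀ := by rw [← hri₀, Category.assoc, hir₀, Category.comp_id]
    simpa [Preadditive.sub_comp] using this
  have hi₁ : i₁ ≫ k ≫ χ = 0 := by
    have : i₁ ≫ (𝟙 F' - k ≫ χ) = i₁ := by rw [← hri₁, reassoc_of% hir₁]
    simpa [Preadditive.comp_sub] using this
  have hr₁ : k ≫ χ ≫ r₁ = 0 := by
    have : (𝟙 F' - k ≫ χ) ≫ r₁ = r₁ := by rw [← hri₁, Category.assoc, hir₁, Category.comp_id]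
    simpa [Preadditive.sub_comp] using this
  have hi₁' : i₁ ≫ k = 0 := by rw [← hk, reassoc_of% hi₁, zero_comp]
  have hr₀' : k ≫ r₀ = 0 := by rw [← hk, Category.assoc, Category.assoc, hr₀, comp_zero]
  have hχ₀ : p • (i₀ ≫ β ≫ r₁) = i₀ ≫ χ ≫ r₁ := by
    rw [← Linear.comp_smul, ← Linear.smul_comp, ← hβ]
    simp [Preadditive.sub_comp, hr₁]
  have hiχ : i₀ ≫ χ = (i₀ ≫ χ ≫ r₁) ≫ i₁ := by
    rw [Category.assoc, Category.assoc, hri₁, Preadditive.comp_sub, Preadditive.comp_sub,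
      reassoc_of% hi₀, zero_comp, sub_zero, Category.comp_id]
  have hχr : χ ≫ r₁ = r₀ ≫ i₀ ≫ χ ≫ r₁ := by
    rw [reassoc_of% hri₀, Preadditive.sub_comp, Category.assoc, hr₁, comp_zero, sub_zero,
      Category.id_comp]
  obtain ⟨c, hc⟩ := exists_cone_iso (n := n) hs u (i₀ ≫ β ≫ r₁) (z + 1 + 1 + 1)
  -- The correction sits at label `z + 3`, away from `z + 1`, where the effect on minimal parts is
  -- prescribed. Since `p d = 0`, adding it preserves commutativity.
  obtain ⟨d, hd, hd₁, hd₂⟩ : ∃ d : ZMod n → (X ⟶ Y),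
      (∀ i, d i = p • if i = z + 1 + 1 + 1 then c else 0) ∧ d (z + 1) = 0 ∧ d (z + 1 + 1) = 0 := by
    refine ⟨_, fun _ => rfl, ?_, ?_⟩
    · rw [if_neg (by rw [add_assoc, left_eq_add]; exact h2), smul_zero]
    · rw [if_neg (by simpa using h1), smul_zero]
  have hpd : ∀ i, p • d i = 0 := fun i => by rw [hd, hC.smul_smul_eq_zero]
  have hc' := hc (minSeqHom (u : R) (fun i => i₀ ≫ χ ≫ r₁ + d i) fun i => by
    rw [smul_add, smul_add, hpd, hpd]) fun i => by
      rw [smul_add, hχ₀, ← hd]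
      rfl
  let ψ : Hom A B := r.g.comp ((minSeqHom (n := n) (p := p) (u : R)
    (fun i => χ + r₀ ≫ d i ≫ i₁) fun i => by
      rw [smul_add, smul_add, ← Linear.comp_smul, ← Linear.smul_comp, hpd, ← Linear.comp_smul,
        ← Linear.smul_comp, hpd]).comp s.f)
  -- The cone of `ψ` reduces to the cone of a morphism with all components multiples of `p`, which
  -- is minimal on `X ⊞ Y` by the choice of `c`.
  have red := Reduction.coneComp r s
    (minSeqHom (n := n) (p := p) (u : R) (fun i => χ + r₀ ≫ d i ≫ i₁) fun i => by
      rw [smul_add, smul_add, ← Linear.comp_smul, ← Linear.smul_comp, hpd, ← Linear.comp_smul,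
        ← Linear.smul_comp, hpd])
    (minSeqHom (u : R) (fun _ => k) fun _ => rfl)
    (minSeqHom (u : R) (fun i => i₀ ≫ χ ≫ r₁ + d i) fun i => by
      rw [smul_add, smul_add, hpd, hpd])
    (minSeqHom (u : R) (fun _ => i₀) fun _ => rfl) (minSeqHom (u : R) (fun _ => r₀) fun _ => rfl)
    (minSeqHom (u : R) (fun _ => i₁) fun _ => rfl) (minSeqHom (u : R) (fun _ => r₁) fun _ => rfl)
    (fun _ => hir₀) (fun _ => hir₁)
    (fun i => by
      change i₀ ≫ (χ + r₀ ≫ d i ≫ i₁) = (i₀ ≫ χ ≫ r₁ + d i) ≫ i₁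
      rw [Preadditive.comp_add, reassoc_of% hir₀, hiχ, Preadditive.add_comp])
    (fun i => by
      change (χ + r₀ ≫ d i ≫ i₁) ≫ r₁ = r₀ ≫ (i₀ ≫ χ ≫ r₁ + d i)
      rw [Preadditive.comp_add, Preadditive.add_comp, hχr, Category.assoc, Category.assoc, hir₁,
        Category.comp_id, reassoc_of% hir₀])
    (fun i => by
      change r₀ ≫ i₀ = 𝟙 F - (χ + r₀ ≫ d i ≫ i₁) ≫ k
      rw [hri₀, Preadditive.add_comp, Category.assoc, Category.assoc, hi₁', comp_zero, comp_zero,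
        add_zero])
    (fun i => by
      change r₁ ≫ i₁ = 𝟙 F' - k ≫ (χ + r₀ ≫ d i ≫ i₁)
      rw [hri₁, Preadditive.comp_add, reassoc_of% hr₀', zero_comp, add_zero])
    (fun _ => hi₁') (fun _ => hr₀')
  obtain ⟨φ, Θ, hφ₁, hφ₂, hΘ⟩ := exists_completion_homotopic hn hAc hBc hA' hB' r s ψ z φ₁ φ₂ hφ (by
    change r.g.app (z + 1) ≫ (χ + r₀ ≫ d (z + 1) ≫ i₁ : F ⟶ F') ≫ s.f.app (z + 1) = _
    rw [hd₁, zero_comp, comp_zero, add_zero, hχ]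
    rfl)
  refine ⟨φ, hφ₁, hφ₂, mem_of_iso (cone_iso_of_homotopy φ ψ Θ hΘ).symm ?_⟩
  obtain ⟨t, ht⟩ := hc'
  exact ⟨hAc.cone hBc ψ, _, ⟨red.ofIsoLeft t ht⟩⟩

variable [HasZeroObject C]

theorem isNAngulation_monodromyClass (hn : 3 ≤ n) (hC : IsRegularMod C p)
    (hs : Even n ∨ 2 * p = 0) (u : Rˣ) :
    IsNAngulation (monodromyClass n p (u : R) : Set (NSigmaSeq C n)) :=
  have : NeZero n := ⟨by omega⟩
  have h4 : ∀ A B, A ∈ monodromyClass n p (u : R) → B ∈ monodromyClass n p (u : R) →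
      ∀ (φ₁ : A.obj 1 ⟶ B.obj 1) (φ₂ : A.obj (1 + 1) ⟶ B.obj (1 + 1)),
      A.map 1 ≫ φ₂ = φ₁ ≫ B.map 1 →
      ∃ φ : Hom A B, φ.app 1 = φ₁ ∧ φ.app (1 + 1) = φ₂ ∧ cone φ ∈ monodromyClass n p (u : R) :=
    fun A B hA hB φ₁ φ₂ h =>
      exists_completion_cone_mem hn hC hs u hA hB (z := 0) (zero_add 1).symm φ₁ φ₂ h
  { directSum_mem := fun _ _ => directSum_mem hC
    summand_mem := fun _ _ => of_directSum_mem hC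
    iso_mem := fun _ _ h => mem_of_iso h
    trivial_mem := fun _ _ h => mem_of_isContractible (h.isCandidate hn) (h.isContractible hn)
    exists_first := exists_mem_first hn hC u
    rotation := leftRotation_mem_iff hn hC hs
    exists_hom := fun A B hA hB φ₁ φ₂ h => by
      obtain ⟨φ, h₁, h₂, -⟩ := h4 A B hA hB φ₁ φ₂ h
      exact ⟨φ, h₁, h₂⟩
    exists_hom_cone := h4 }

end Angulation

/-! ### Classification of the angulations -/

section Classification

variable {C : Type u} [Category.{v} C] [Preadditive C] [HasBinaryBiproducts C] {n : ℕ}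

theorem isZero_biprod {X Y : C} (hX : IsZero X) (hY : IsZero Y) : IsZero (X ⊞ Y) := by
  rw [IsZero.iff_id_eq_zero]
  ext
  · exact hX.eq_of_src _ _
  · exact hX.eq_of_src _ _
  · exact hY.eq_of_src _ _
  · exact hY.eq_of_src _ _

theorem coneId_isTrivialOn {Y : ZMod n → C} (h : ∀ i, i ≠ 1 + 1 → IsZero (Y i))
    (hn : 3 ≤ n) : (coneId Y).IsTrivialOn (Y (1 + 1)) := by
  have h1 := ZMod.one_ne_zero_of_three_le hn
  refine ⟨⟨⟨(biprod.fst : Y (1 + 1) ⊞ Y 1 ⟶ _), biprod.inl, ?_, biprod.inl_fst⟩,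
    ⟨(biprod.snd : Y (1 + 1 + 1) ⊞ Y (1 + 1) ⟶ _), biprod.inr, ?_, biprod.inr_snd⟩, ?_⟩,
    fun i hi hi' => isZero_biprod (h (i + 1) fun h' => hi (add_right_cancel h')) (h i hi')⟩
  · change biprod.fst ≫ biprod.inl = 𝟙 (Y (1 + 1) ⊞ Y 1)
    ext
    · simp
    · simp
    · exact (h 1 (by simpa using h1)).eq_of_src _ _
    · exact (h 1 (by simpa using h1)).eq_of_src _ _
  · change biprod.snd ≫ biprod.inr = 𝟙 (Y (1 + 1 + 1) ⊞ Y (1 + 1))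
    ext
    · exact (h (1 + 1 + 1) (by simpa using h1)).eq_of_src _ _
    · exact (h (1 + 1 + 1) (by simpa using h1)).eq_of_src _ _
    · simp
    · simp
  · change (biprod.fst ≫ biprod.inr) ≫ biprod.snd = biprod.fst
    simp

theorem exists_isTrivialOn [HasZeroObject C] (hn : 3 ≤ n) (X : C) :
    ∃ T : NSigmaSeq C n, T.IsTrivialOn X := by
  open scoped ZeroObject in
  obtain ⟨Y, hY, hY'⟩ : ∃ Y : ZMod n → C, Y (1 + 1) = X ∧ ∀ i, i ≠ 1 + 1 → IsZero (Y i) :=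
    ⟨fun i => if i = 1 + 1 then X else 0, if_pos rfl, fun i hi => by
      dsimp only
      rw [if_neg hi]
      exact isZero_zero C⟩
  subst hY
  exact ⟨_, coneId_isTrivialOn hY' hn⟩

/-- The sequences `coneId Y` are additive in `Y`. -/
theorem coneId_iso_directSum {Y Y' Y'' : ZMod n → C} (e : ∀ i, Y i ≅ Y' i ⊞ Y'' i) :
    Isomorphic ((coneId Y').directSum (coneId Y'')) (coneId Y) := by
  have h : ∀ i, (e i).hom ≫ biprod.fst ≫ biprod.inl ≫ (e i).inv +
      (e i).hom ≫ biprod.snd ≫ biprod.inr ≫ (e i).inv = 𝟙 (Y i) := fun i => by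
    have := congrArg (fun t => (e i).hom ≫ t ≫ (e i).inv) (biprod.total (X := Y' i) (Y := Y'' i))
    simpa only [Preadditive.comp_add, Preadditive.add_comp, Category.assoc, Category.id_comp,
      Iso.hom_inv_id] using this
  let f : ∀ i, (Y' (i + 1) ⊞ Y' i) ⊞ (Y'' (i + 1) ⊞ Y'' i) ⟶ Y (i + 1) ⊞ Y i := fun i =>
    biprod.desc (biprod.map (biprod.inl ≫ (e (i + 1)).inv) (biprod.inl ≫ (e i).inv))
      (biprod.map (biprod.inr ≫ (e (i + 1)).inv) (biprod.inr ≫ (e i).inv))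
  let g : ∀ i, Y (i + 1) ⊞ Y i ⟶ (Y' (i + 1) ⊞ Y' i) ⊞ (Y'' (i + 1) ⊞ Y'' i) := fun i =>
    biprod.lift (biprod.map ((e (i + 1)).hom ≫ biprod.fst) ((e i).hom ≫ biprod.fst))
      (biprod.map ((e (i + 1)).hom ≫ biprod.snd) ((e i).hom ≫ biprod.snd))
  refine .of_inverse ⟨f, fun i => ?_⟩ g (fun i => ?_) (fun i => ?_)
  · change biprod.map (biprod.fst ≫ biprod.inr : Y' (i + 1) ⊞ Y' i ⟶ Y' (i + 1 + 1) ⊞ Y' (i + 1))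
      (biprod.fst ≫ biprod.inr : Y'' (i + 1) ⊞ Y'' i ⟶ Y'' (i + 1 + 1) ⊞ Y'' (i + 1)) ≫
        f (i + 1) = f i ≫ (biprod.fst ≫ biprod.inr : Y (i + 1) ⊞ Y i ⟶ Y (i + 1 + 1) ⊞ Y (i + 1))
    ext <;> simp [f]
  · change f i ≫ g i = 𝟙 ((Y' (i + 1) ⊞ Y' i) ⊞ (Y'' (i + 1) ⊞ Y'' i))
    ext <;> simp [f, g]
  · change g i ≫ f i = 𝟙 (Y (i + 1) ⊞ Y i)
    ext <;> simp [f, g, biprod.lift_desc, h]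

/-- The sign introduced by rotation is absorbed by rescaling the first summand at the same label. -/
theorem coneId_leftRotation (Y : ZMod n → C) :
    Isomorphic (coneId fun i => Y (i + 1)) (coneId Y).leftRotation := by
  refine .of_inverse ⟨fun i => (biprod.map (rotSign i • 𝟙 _) (𝟙 _) :
      Y (i + 1 + 1) ⊞ Y (i + 1) ⟶ Y (i + 1 + 1) ⊞ Y (i + 1)), fun i => ?_⟩
    (fun i => (biprod.map (rotSign i • 𝟙 _) (𝟙 _) :
      Y (i + 1 + 1) ⊞ Y (i + 1) ⟶ Y (i + 1 + 1) ⊞ Y (i + 1))) (fun i => ?_) (fun i => ?_)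
  · rw [leftRotation_map]
    change (biprod.fst ≫ biprod.inr) ≫ biprod.map (rotSign (i + 1) • 𝟙 (Y (i + 1 + 1 + 1)))
      (𝟙 (Y (i + 1 + 1))) = biprod.map (rotSign i • 𝟙 (Y (i + 1 + 1))) (𝟙 (Y (i + 1))) ≫
        (rotSign i • (biprod.fst ≫ biprod.inr :
          Y (i + 1 + 1) ⊞ Y (i + 1) ⟶ Y (i + 1 + 1 + 1) ⊞ Y (i + 1 + 1)))
    ext <;> simp [rotSign_smul_smul]
  all_goals
    change biprod.map (rotSign i • 𝟙 (Y (i + 1 + 1))) (𝟙 (Y (i + 1))) ≫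
      biprod.map (rotSign i • 𝟙 (Y (i + 1 + 1))) (𝟙 (Y (i + 1))) =
        𝟙 (Y (i + 1 + 1) ⊞ Y (i + 1))
    ext <;> simp [rotSign_smul_smul]

variable {N : Set (NSigmaSeq C n)} [HasZeroObject C]

/-- By (N3) the square from the trivial sequence on `A_1` extends, and the composite `α_2 α_1` then
factors through the zero object at label `3`. Rotation gives the other composites. -/
theorem isCandidate_of_mem_angulation (hn : 3 ≤ n) (hN : IsPreNAngulation N) {A : NSigmaSeq C n}
    (hA : A ∈ N) : A.IsCandidate := by
  have : NeZero n := ⟨by omega⟩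
  have h1 := ZMod.one_ne_zero_of_three_le hn
  have h2 := ZMod.one_add_one_ne_zero_of_three_le hn
  suffices h : ∀ i, ∀ A ∈ N, A.map i ≫ A.map (i + 1) = 0 from fun i => h i A hA
  refine ZMod.cyclic_induction 1 (fun A hA => ?_) fun i hi A hA => ?_
  · obtain ⟨T, hT⟩ := exists_isTrivialOn (n := n) hn (A.obj 1)
    have hTN := hN.trivial_mem _ _ hT
    obtain ⟨⟨e, f, hef⟩, hz⟩ := hT
    obtain ⟨φ, hφ₁, hφ₂⟩ := hN.exists_hom T A hTN hA e.hom (f.hom ≫ A.map 1) (by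
      rw [← Category.assoc, hef])
    have hc := φ.comm (1 + 1)
    rw [hφ₂, (hz (1 + 1 + 1) (by rw [add_assoc, Ne, add_eq_left]; exact h2)
      (by simpa using h1)).eq_of_tgt (T.map (1 + 1)) 0, zero_comp, Category.assoc] at hc
    rw [← cancel_epi f.hom, ← hc, comp_zero]
  · have h := hi _ ((hN.rotation A).1 hA)
    rw [leftRotation_map, leftRotation_map] at h
    change (rotSign i • A.map (i + 1)) ≫ (rotSign (i + 1) • A.map (i + 1 + 1)) = 0 at h
    rw [Preadditive.zsmul_comp, Preadditive.comp_zsmul] at h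
    exact rotSign_smul_eq_zero (rotSign_smul_eq_zero h)

/-- A map `x` killed by `α_2` together with zero forms a square from the rotated trivial sequence on
`X`; the component of its extension at label `0` lifts `x` through `α_1`. -/
theorem isExact_of_mem_angulation (hn : 3 ≤ n) (hN : IsPreNAngulation N) {A : NSigmaSeq C n}
    (hA : A ∈ N) : A.IsExact := by
  have : NeZero n := ⟨by omega⟩
  have h1 := ZMod.one_ne_zero_of_three_le hn
  have h2 := ZMod.one_add_one_ne_zero_of_three_le hn
  suffices h : ∀ i, ∀ A ∈ N, ∀ {X : C} (x : X ⟶ A.obj (i + 1)), x ≫ A.map (i + 1) = 0 →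
      ∃ y, x = y ≫ A.map i from fun i => h i A hA
  refine ZMod.cyclic_induction 1 (fun A hA X x hx => ?_) fun i hi A hA X x hx => ?_
  · obtain ⟨T, hT⟩ := exists_isTrivialOn (n := n) hn X
    have hTN := hN.trivial_mem _ _ hT
    obtain ⟨⟨e, f, hef⟩, hz⟩ := hT
    have hz3 := hz (1 + 1 + 1) (by rw [add_assoc, Ne, add_eq_left]; exact h2) (by simpa using h1)
    obtain ⟨φ, hφ₁, -⟩ := hN.exists_hom T.leftRotation A.leftRotation ((hN.rotation T).1 hTN)
      ((hN.rotation A).1 hA) (f.hom ≫ x) 0 (by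
        rw [leftRotation_map A]
        change _ = (f.hom ≫ x) ≫ (rotSign 1 • A.map (1 + 1))
        rw [Preadditive.comp_zsmul, Category.assoc, hx, comp_zero, comp_zero, smul_zero]
        rfl)
    -- The square needed is the one at label `0` of the rotation; the labels `1` and `0 + 1` must be
    -- identified by substitution.
    have key : ∀ j z : ZMod n, j = z + 1 → ∀ (x : X ⟶ A.obj (j + 1)) (e : T.obj j ≅ X)
        (f : T.obj (j + 1) ≅ X), T.map j ≫ f.hom = e.hom → φ.app j = f.hom ≫ x →
        ∃ y, x = y ≫ A.map j := by
      rintro _ z rfl x e f hef hφ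
      obtain ⟨t, ht⟩ : ∃ t : T.obj (z + 1) ⟶ A.obj (z + 1), φ.app z = t := ⟨_, rfl⟩
      have hc := φ.comm z
      rw [leftRotation_map, leftRotation_map, hφ, ht] at hc
      change (rotSign z • T.map (z + 1)) ≫ f.hom ≫ x = t ≫ (rotSign z • A.map (z + 1)) at hc
      rw [Preadditive.zsmul_comp, Preadditive.comp_zsmul, reassoc_of% hef] at hc
      have hc' := congrArg (fun t => rotSign z • t) hc
      simp only [rotSign_smul_smul] at hc'
      exact ⟨e.inv ≫ t, by rw [Category.assoc, ← hc', Iso.inv_hom_id_assoc]⟩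
    exact key 1 0 (zero_add 1).symm x e f hef hφ₁
  · obtain ⟨y, hy⟩ := hi _ ((hN.rotation A).1 hA) x (by
      rw [leftRotation_map]
      change x ≫ (rotSign (i + 1) • A.map (i + 1 + 1)) = 0
      rw [Preadditive.comp_zsmul, hx, smul_zero])
    change X ⟶ A.obj (i + 1) at y
    refine ⟨rotSign i • y, ?_⟩
    rw [hy, leftRotation_map]
    change y ≫ (rotSign i • A.map (i + 1)) = _
    rw [Preadditive.comp_zsmul, Preadditive.zsmul_comp]

/-- A family supported at one label gives a rotated trivial sequence; a general family is a direct
sum of these, by induction on the support. -/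
theorem coneId_mem_angulation (hn : 3 ≤ n) (hN : IsPreNAngulation N) (Y : ZMod n → C) :
    coneId Y ∈ N := by
  have : NeZero n := ⟨by omega⟩
  have single : ∀ j, ∀ Y : ZMod n → C, (∀ i, i ≠ j → IsZero (Y i)) → coneId Y ∈ N := by
    refine ZMod.cyclic_induction (1 + 1)
      (fun Y hY => hN.trivial_mem _ _ (coneId_isTrivialOn hY hn)) fun j hj Y hY => ?_
    rw [hN.rotation]
    exact hN.iso_mem _ _ (coneId_leftRotation Y)
      (hj _ fun i hi => hY _ fun h => hi (add_right_cancel h))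
  suffices h : ∀ (S : Finset (ZMod n)) (Y : ZMod n → C), (∀ i, i ∉ S → IsZero (Y i)) →
      coneId Y ∈ N from h Finset.univ Y fun i hi => absurd (Finset.mem_univ i) hi
  intro S
  induction S using Finset.induction_on with
  | empty => exact fun Y hY => single 1 Y fun i _ => hY i (Finset.notMem_empty i)
  | insert j S _ ih =>
    intro Y hY
    have hx : ∀ i, ∃ X' X'' : C, Nonempty (Y i ≅ X' ⊞ X'') ∧ (i ∉ S → IsZero X') ∧
        (i ≠ j → IsZero X'') := fun i => by
      open scoped ZeroObject in
      by_cases h : i = j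
      · exact ⟨0, Y i, ⟨⟨biprod.inr, biprod.snd, by simp, by
          rw [← biprod.total, (isZero_zero C).eq_of_tgt biprod.fst 0, zero_comp, zero_add]⟩⟩, fun _ => isZero_zero C, fun h' => absurd h h'⟩
      · exact ⟨Y i, 0, ⟨⟨biprod.inl, biprod.fst, by simp, by
          rw [← biprod.total, (isZero_zero C).eq_of_tgt biprod.snd 0, zero_comp, add_zero]⟩⟩,
          fun h' => hY i (by simp [h, h']), fun _ => isZero_zero C⟩
    choose Y' Y'' e hY' hY'' using hx
    exact hN.iso_mem _ _ (coneId_iso_directSum fun i => (e i).some)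
      (hN.directSum_mem _ _ (ih Y' hY') (single j Y'' hY''))

/-- A contraction `Θ` makes `K` a retract of `coneId K.obj`, by the maps `(α, 1)` and `(Θ, 1 - α ≫
Θ)`, hence a direct summand of a member. -/
theorem mem_angulation_of_isContractible
    (hsplit : ∀ {X : C} (e : X ⟶ X), e ≫ e = e → ∃ (P : C) (i : P ⟶ X) (r : X ⟶ P),
      i ≫ r = 𝟙 P ∧ r ≫ i = e) (hn : 3 ≤ n) (hN : IsPreNAngulation N) {K : NSigmaSeq C n}
    (hK : K.IsCandidate) (h : K.IsContractible) : K ∈ N := by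
  obtain ⟨Θ, hΘ⟩ := h.exists_homotopy
  have hΘ' : ∀ i, K.map i ≫ Θ i ≫ K.map i = K.map i := fun i => by
    have := congrArg (fun t => K.map i ≫ t) (hΘ i)
    simp only [Category.comp_id, Preadditive.comp_add, reassoc_of% (hK i), zero_comp,
      zero_add] at this
    exact this.symm
  obtain ⟨L, _, _, _, _, _, hL⟩ := exists_iso_directSum hsplit (G := K) (A := coneId K.obj)
    ⟨fun i => biprod.lift (K.map i) (𝟙 _), fun i => by
      change K.map i ≫ biprod.lift (K.map (i + 1)) (𝟙 (K.obj (i + 1))) =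
        biprod.lift (K.map i) (𝟙 (K.obj i)) ≫ biprod.fst ≫ biprod.inr
      ext <;> simp [hK i]⟩
    ⟨fun i => biprod.desc (Θ i) (𝟙 _ - K.map i ≫ Θ i), fun i => by
      change (biprod.fst ≫ biprod.inr) ≫ biprod.desc (Θ (i + 1))
        (𝟙 (K.obj (i + 1)) - K.map (i + 1) ≫ Θ (i + 1)) =
          biprod.desc (Θ i) (𝟙 (K.obj i) - K.map i ≫ Θ i) ≫ K.map i
      ext
      · simp [hΘ i]
      · simp [Preadditive.sub_comp, hΘ']⟩
    (fun i => by
      change biprod.lift (K.map i) (𝟙 (K.obj i)) ≫ biprod.desc (Θ i)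
        (𝟙 (K.obj i) - K.map i ≫ Θ i) = 𝟙 (K.obj i)
      simp [biprod.lift_desc])
  exact hN.summand_mem _ L (hN.iso_mem _ _ (hL.trans (directSum_comm L K))
    (coneId_mem_angulation hn hN K.obj))

variable {R : Type w} [CommRing R] [Linear R C] {p : R}

theorem mem_angulation_iff_of_reduction (hn : 3 ≤ n) (hC : IsRegularMod C p)
    (hN : IsPreNAngulation N) {A G : NSigmaSeq C n} (hA : A.IsCandidate) (r : Reduction G A) :
    A ∈ N ↔ G ∈ N := by
  obtain ⟨K, hK, hK', h⟩ := r.exists_iso_directSum hC.split hA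
  refine ⟨fun h' => hN.summand_mem _ K (hN.iso_mem _ _ (h.trans (directSum_comm K G)) h'),
    fun h' => hN.iso_mem _ _ h.symm (hN.directSum_mem _ _ ?_ h')⟩
  exact mem_angulation_of_isContractible hC.split hn hN hK hK'

/-- A first map which is `p` times an isomorphism determines the rank of the minimal sequence. -/
theorem nonempty_iso_of_map_eq_smul (hC : IsRegularMod C p) {A : NSigmaSeq C n}
    (hA : A.IsCandidate) {F : C} {M : F ⟶ F} (r : Reduction (minSeq n p M) A) {j z : ZMod n}
    (hj : j = z + 1) (w : A.obj j ⟶ A.obj (j + 1)) [IsIso w] (hw : A.map j = p • w) :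
    Nonempty (F ≅ A.obj j) := by
  subst hj
  -- Both maps adjacent to this object are multiples of `p`, so the idempotent onto the minimal part
  -- is the identity modulo `p`, hence the identity.
  obtain ⟨y, hy⟩ := hC.exists_eq_smul (A.map z) (by
    have h := hA z
    rw [hw, Linear.comp_smul, ← Linear.smul_comp, ← zero_comp, cancel_mono] at h
    exact h)
  have h1 := r.homotopy z
  have h2 : 𝟙 _ - r.g.app (z + 1) ≫ r.f.app (z + 1) = p • (w ≫ r.h (z + 1) + r.h z ≫ y) := by
    rw [← h1, hw, hy, Linear.smul_comp, Linear.comp_smul, smul_add]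
  have h3 := hC.isIso_of_one_sub _ _ h2
  have h4 : r.g.app (z + 1) ≫ r.f.app (z + 1) = 𝟙 _ := by
    rw [← cancel_epi (r.g.app (z + 1) ≫ r.f.app (z + 1)), Category.comp_id, Category.assoc,
      r.f_g_assoc]
  exact ⟨⟨r.f.app (z + 1), r.g.app (z + 1), r.f_g (z + 1), h4⟩⟩

/-- A member with first map `p · 1_F` reduces to a minimal sequence on an object isomorphic to `F`.
-/
theorem exists_minSeq_mem_angulation (hn : 3 ≤ n) (hC : IsRegularMod C p)
    (hN : IsPreNAngulation N) (F : C) : ∃ M : F ⟶ F, IsIso M ∧ minSeq n p M ∈ N := by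
  have : NeZero n := ⟨by omega⟩
  obtain ⟨A, hA, e, f, h⟩ := hN.exists_first (p • 𝟙 F)
  have hA' := isCandidate_of_mem_angulation hn hN hA
  obtain ⟨F₀, M, hM, ⟨r⟩⟩ := exists_reduction_minSeq hC hA' (isExact_of_mem_angulation hn hN hA)
  obtain ⟨e'⟩ := nonempty_iso_of_map_eq_smul hC hA' r (z := 0) (zero_add 1).symm (e.hom ≫ f.inv) (by
    rw [← cancel_mono f.hom, h]
    simp)
  have hm := (mem_angulation_iff_of_reduction hn hC hN hA' r).1 hA
  let κ : F₀ ≅ F := e' ≪≫ e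
  refine ⟨κ.inv ≫ M ≫ κ.hom, inferInstance, hN.iso_mem _ _ ⟨⟨fun _ => κ.hom, fun i => ?_⟩,
    fun i => κ.isIso_hom⟩ hm⟩
  rw [minSeq_map, minSeq_map]
  change (p • (if i = 1 then M else 𝟙 F₀)) ≫ κ.hom =
    κ.hom ≫ (p • (if i = 1 then κ.inv ≫ M ≫ κ.hom else 𝟙 F))
  split_ifs <;> simp

/-- Naturality of the monodromy: (N3) extends `χ`, with second component `M⁻¹ χ M'`, to a morphism,
whose components must agree after multiplication by `p`. -/
theorem smul_comp_eq_of_mem_angulation (hn : 3 ≤ n) (hN : IsPreNAngulation N) {F F' : C}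
    {M : F ⟶ F} {M' : F' ⟶ F'} [IsIso M] (h : minSeq n p M ∈ N) (h' : minSeq n p M' ∈ N)
    (χ : F ⟶ F') : p • (M ≫ χ) = p • (χ ≫ M') := by
  have : NeZero n := ⟨by omega⟩
  obtain ⟨φ, hφ, -⟩ := hN.exists_hom _ _ h h' χ (inv M ≫ χ ≫ M' : F ⟶ F') (by
    rw [minSeq_map, minSeq_map, if_pos rfl, if_pos rfl]
    change (p • M) ≫ inv M ≫ χ ≫ M' = χ ≫ (p • M')
    simp)
  exact (smul_app_minSeq φ χ hφ).2

/-- The classification of the angulations of a category with a generator whose automorphisms are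
scalars. -/
theorem exists_eq_monodromyClass (hn : 3 ≤ n) (hC : IsRegularMod C p) (I : C)
    (hI : ∀ M : I ⟶ I, IsIso M → ∃ u : Rˣ, M = (u : R) • 𝟙 I)
    (hI' : ∀ {F F' : C} (f g : F ⟶ F'), (∀ χ : I ⟶ F, χ ≫ f = χ ≫ g) → f = g)
    (hN : IsPreNAngulation N) : ∃ u : Rˣ, N = monodromyClass n p (u : R) := by
  have : NeZero n := ⟨by omega⟩
  obtain ⟨M₀, hM₀, h₀⟩ := exists_minSeq_mem_angulation hn hC hN I
  obtain ⟨u, rfl⟩ := hI M₀ hM₀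
  -- Naturality against all maps from the generator `I` forces every monodromy in `N` to be the
  -- scalar `u`, up to what `p` kills.
  have key : ∀ {F : C} (M : F ⟶ F), minSeq n p M ∈ N → p • M = p • (u : R) • 𝟙 F :=
    fun M hM => hI' _ _ fun χ => by
      have := smul_comp_eq_of_mem_angulation hn hN h₀ hM χ
      rw [Linear.comp_smul, ← this]
      simp
  refine ⟨u, Set.ext fun A => ⟨fun hA => ?_, fun hA => ?_⟩⟩
  · have hA' := isCandidate_of_mem_angulation hn hN hA
    obtain ⟨F, M, hM, ⟨r⟩⟩ := exists_reduction_minSeq hC hA' (isExact_of_mem_angulation hn hN hA)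
    have h1 := key M ((mem_angulation_iff_of_reduction hn hC hN hA' r).1 hA)
    exact ⟨hA', F, ⟨by rw [← minSeq_congr h1]; exact r⟩⟩
  · obtain ⟨hA', F, ⟨r⟩⟩ := hA
    obtain ⟨M, hM, h⟩ := exists_minSeq_mem_angulation hn hC hN F
    rw [mem_angulation_iff_of_reduction hn hC hN hA' r, ← minSeq_congr (key M h)]
    exact h

end Classification

end NSigmaSeq

/-! ### Finitely generated free modules over the local ring -/

section LinearAlgebra

/-- A section of `f` onto its range extends to the whole target. -/
theorem LinearMap.exists_comp_comp_eq_self {K V W : Type*} [Field K] [AddCommGroup V] [Module K V]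
    [AddCommGroup W] [Module K W] (f : V →ₗ[K] W) : ∃ g : W →ₗ[K] V, f ∘ₗ g ∘ₗ f = f := by
  obtain ⟨s, hs⟩ := f.rangeRestrict.exists_rightInverse_of_surjective f.range_rangeRestrict
  obtain ⟨g, hg⟩ := LinearMap.exists_extend s
  refine ⟨g, LinearMap.ext fun x => ?_⟩
  have h1 : g (f x) = s (f.rangeRestrict x) := LinearMap.congr_fun hg (f.rangeRestrict x)
  have h2 := congrArg Subtype.val (LinearMap.congr_fun hs (f.rangeRestrict x))
  change f (g (f x)) = f x
  rw [h1]
  exact h2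

theorem Matrix.exists_mul_mul_eq_self {K : Type*} [Field K] {m n : Type*} [Fintype m] [Fintype n]
    [DecidableEq m] [DecidableEq n] (A : Matrix m n K) : ∃ B : Matrix n m K, A * (B * A) = A := by
  obtain ⟨g, hg⟩ := (Matrix.toLin' A).exists_comp_comp_eq_self
  refine ⟨LinearMap.toMatrix' g, Matrix.toLin'.injective ?_⟩
  rw [Matrix.toLin'_mul, Matrix.toLin'_mul, Matrix.toLin'_toMatrix', hg]

variable {R : Type*} [CommRing R] {M N : Type*} [AddCommGroup M] [Module R M]
  [AddCommGroup N] [Module R N] [Module.Finite R M] [Module.Free R M] [Module.Finite R N]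
  [Module.Free R N] {p : R}

theorem LinearMap.exists_eq_smul_of_toMatrix {ι κ : Type*} [Fintype ι] [Fintype κ]
    [DecidableEq ι] [DecidableEq κ] (b : Module.Basis ι R M) (c : Module.Basis κ R N)
    (f : M →ₗ[R] N)
    (h : ∀ i j, ∃ r, LinearMap.toMatrix b c f i j = p * r) : ∃ g : M →ₗ[R] N, f = p • g := by
  choose D hD using h
  refine ⟨Matrix.toLin b c (Matrix.of D), (LinearMap.toMatrix b c).injective ?_⟩
  rw [map_smul, LinearMap.toMatrix_toLin]
  ext i j
  exact hD i j

variable [IsLocalRing R]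

theorem IsLocalRing.exists_eq_mul_of_mem (hp : IsLocalRing.maximalIdeal R = Ideal.span {p}) {r : R}
    (hr : r ∈ IsLocalRing.maximalIdeal R) : ∃ s, r = p * s := by
  rw [hp, Ideal.mem_span_singleton'] at hr
  obtain ⟨s, rfl⟩ := hr
  exact ⟨s, mul_comm _ _⟩

/-- A matrix entry killed by `p ≠ 0` is not a unit, hence lies in `(p)`. -/
theorem LinearMap.exists_eq_smul_of_smul_eq_zero
    (hp : IsLocalRing.maximalIdeal R = Ideal.span {p}) (hp₀ : p ≠ 0) (f : M →ₗ[R] N)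
    (hf : p • f = 0) : ∃ g : M →ₗ[R] N, f = p • g := by
  classical
  let b := Module.Free.chooseBasis R M
  let c := Module.Free.chooseBasis R N
  refine f.exists_eq_smul_of_toMatrix b c fun i j => IsLocalRing.exists_eq_mul_of_mem hp ?_
  have h : p * LinearMap.toMatrix b c f i j = 0 := by
    have := congrArg (fun t => LinearMap.toMatrix b c t i j) hf
    simpa using this
  rw [IsLocalRing.mem_maximalIdeal, mem_nonunits_iff]
  intro hu
  exact hp₀ (hu.mul_left_eq_zero.1 h)

/-- Any lift of a quasi-inverse over the residue field works: the error has entries in the maximal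
ideal `(p)`. -/
theorem LinearMap.exists_sub_comp_comp_eq_smul
    (hp : IsLocalRing.maximalIdeal R = Ideal.span {p}) (f : M →ₗ[R] N) :
    ∃ (g : N →ₗ[R] M) (d : M →ₗ[R] N), f - f ∘ₗ g ∘ₗ f = p • d := by
  classical
  let b := Module.Free.chooseBasis R M
  let c := Module.Free.chooseBasis R N
  set A := LinearMap.toMatrix b c f with hA
  obtain ⟨B, hB⟩ := (A.map (IsLocalRing.residue R)).exists_mul_mul_eq_self
  choose D hD using fun i j => IsLocalRing.residue_surjective (R := R) (B i j)
  have hB' : (Matrix.of D).map (IsLocalRing.residue R) = B := by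
    ext i j
    exact hD i j
  refine ⟨Matrix.toLin c b (Matrix.of D), exists_eq_smul_of_toMatrix b c _ fun i j =>
    IsLocalRing.exists_eq_mul_of_mem hp ?_⟩
  have h : LinearMap.toMatrix b c (f - f ∘ₗ Matrix.toLin c b (Matrix.of D) ∘ₗ f) =
      A - A * (Matrix.of D * A) := by
    rw [map_sub, LinearMap.toMatrix_comp b b c, LinearMap.toMatrix_comp b c b,
      LinearMap.toMatrix_toLin]
  rw [h, ← IsLocalRing.residue_eq_zero_iff, ← Matrix.map_apply (f := IsLocalRing.residue R),
    Matrix.map_sub _ (map_sub _), Matrix.map_mul, Matrix.map_mul, hB', hB, sub_self]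
  rfl

end LinearAlgebra

variable {R : Type u} [CommRing R] {p : R}

/-! ### The category `FGFree R` is regular modulo `p` -/

namespace FGFree

/-- The image of an idempotent is a direct summand, hence finite projective, hence free over a local
ring. -/
theorem exists_isSplitting [IsLocalRing R] {X : FGFree R} (e : X ⟶ X) (he : e ≫ e = e) :
    ∃ (P : FGFree R) (i : P ⟶ X) (r : X ⟶ P), i ≫ r = 𝟙 P ∧ r ≫ i = e := by
  have : Module.Finite R X.obj := X.property.1
  have : Module.Free R X.obj := X.property.2
  let f : X.obj →ₗ[R] X.obj := e.hom.hom
  have hf : ∀ x, f (f x) = f x := fun x => LinearMap.congr_fun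
    (congrArg (fun t : X ⟶ X => t.hom.hom) he) x
  have hs : f.rangeRestrict ∘ₗ (LinearMap.range f).subtype = LinearMap.id := by
    ext ⟨_, x, rfl⟩
    exact hf x
  have : Module.Projective R (LinearMap.range f) := .of_split _ _ hs
  have : Module.Free R (LinearMap.range f) := Module.free_of_flat_of_isLocalRing
  refine ⟨⟨ModuleCat.of R (LinearMap.range f), (inferInstance : Module.Finite R _),
    (inferInstance : Module.Free R _)⟩,
    ObjectProperty.homMk (ModuleCat.ofHom (LinearMap.range f).subtype),
    ObjectProperty.homMk (ModuleCat.ofHom f.rangeRestrict), ?_, rfl⟩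
  exact ObjectProperty.hom_ext _ (ModuleCat.hom_ext hs)

theorem isRegularMod [IsLocalRing R] (hp : IsLocalRing.maximalIdeal R = Ideal.span {p})
    (hne : IsLocalRing.maximalIdeal R ≠ ⊥) (hsq : IsLocalRing.maximalIdeal R ^ 2 = ⊥) :
    IsRegularMod (FGFree R) p where
  sq := by
    rw [hp, Ideal.span_singleton_pow, Ideal.span_singleton_eq_bot] at hsq
    rw [← hsq, sq]
  exists_eq_smul {X Y} f hf := by
    have : Module.Finite R X.obj := X.property.1
    have : Module.Free R X.obj := X.property.2
    have : Module.Finite R Y.obj := Y.property.1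
    have : Module.Free R Y.obj := Y.property.2
    obtain ⟨g, hg⟩ := LinearMap.exists_eq_smul_of_smul_eq_zero hp (fun h => hne (by rw [hp, h]; simp))
      f.hom.hom (congrArg (fun t : X ⟶ Y => t.hom.hom) hf)
    exact ⟨ObjectProperty.homMk (ModuleCat.ofHom g), ObjectProperty.hom_ext _ (ModuleCat.hom_ext hg)⟩
  exists_regular {X Y} f := by
    have : Module.Finite R X.obj := X.property.1
    have : Module.Free R X.obj := X.property.2
    have : Module.Finite R Y.obj := Y.property.1
    have : Module.Free R Y.obj := Y.property.2
    obtain ⟨g, d, h⟩ := LinearMap.exists_sub_comp_comp_eq_smul hp f.hom.hom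
    exact ⟨ObjectProperty.homMk (ModuleCat.ofHom g), ObjectProperty.homMk (ModuleCat.ofHom d),
      ObjectProperty.hom_ext _ (ModuleCat.hom_ext h)⟩
  split := exists_isSplitting

variable (R) in
/-- The free module of rank one. -/
def unit : FGFree R :=
  ⟨ModuleCat.of R R, (inferInstance : Module.Finite R R), (inferInstance : Module.Free R R)⟩

theorem exists_eq_smul_id (M : unit R ⟶ unit R) : ∃ r : R, M = r • 𝟙 (unit R) := by
  let f : R →ₗ[R] R := M.hom.hom
  have h : f = f 1 • LinearMap.id := LinearMap.ext_ring (mul_one _).symm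
  exact ⟨f 1, ObjectProperty.hom_ext _ (ModuleCat.hom_ext h)⟩

theorem smul_id_injective {r s : R} (h : r • 𝟙 (unit R) = s • 𝟙 (unit R)) : r = s := by
  have : r * 1 = s * 1 := LinearMap.congr_fun
    (congrArg (fun t : unit R ⟶ unit R => t.hom.hom) h) (1 : R)
  simpa using this

theorem exists_units_eq_smul_id (M : unit R ⟶ unit R) (hM : IsIso M) :
    ∃ u : Rˣ, M = (u : R) • 𝟙 (unit R) := by
  obtain ⟨r, hr⟩ := exists_eq_smul_id M
  obtain ⟨s, hs⟩ := exists_eq_smul_id (inv M)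
  have h : r * s = 1 := smul_id_injective (by
    calc (r * s) • 𝟙 (unit R) = M ≫ inv M := by
          rw [hs, hr]
          simp [smul_smul, mul_comm]
      _ = (1 : R) • 𝟙 (unit R) := by rw [IsIso.hom_inv_id, one_smul])
  exact ⟨⟨r, s, h, (mul_comm _ _).trans h⟩, hr⟩

theorem hom_ext_of_unit {F F' : FGFree R} (f g : F ⟶ F')
    (h : ∀ χ : unit R ⟶ F, χ ≫ f = χ ≫ g) : f = g := by
  refine ObjectProperty.hom_ext _ (ModuleCat.hom_ext (LinearMap.ext fun x => ?_))
  have := congrArg (fun t : unit R ⟶ F' => t.hom.hom (1 : R))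
    (h (ObjectProperty.homMk (ModuleCat.ofHom (LinearMap.toSpanSingleton R F.obj x))))
  have h1 : f.hom.hom ((1 : R) • x) = g.hom.hom ((1 : R) • x) := this
  rwa [one_smul] at h1

end FGFree

/-! ### Identification of `angleClass` and the main theorem -/

open NSigmaSeq

/-- The identity reduction. -/
def NSigmaSeq.Reduction.refl {C : Type u} [Category.{v} C] [Preadditive C] {n : ℕ}
    (A : NSigmaSeq C n) : Reduction A A where
  f := .id A
  g := .id A
  h _ := 0
  f_g _ := Category.id_comp _
  homotopy _ := by simp [Hom.id]
  f_h _ := comp_zero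
  h_g _ := zero_comp

theorem freeSeq_eq_minSeq (n : ℕ) (p u : R) (F : FGFree R) :
    freeSeq n p u F = minSeq n p (u • 𝟙 F) := by
  simp only [freeSeq, minSeq, smul_smul, mul_comm]

/-- Discarding a contractible summand is a reduction, and conversely a reduction of a candidate
splits off a contractible candidate because idempotents split. -/
theorem angleClass_eq_monodromyClass {n : ℕ} (hC : IsRegularMod (FGFree R) p) (u : R) :
    angleClass n p u = monodromyClass n p u := by
  ext A
  constructor
  · rintro ⟨K, F, hK, hK', h⟩
    rw [freeSeq_eq_minSeq] at h
    exact ⟨(hK.directSum (minSeq_isCandidate hC _)).of_iso h.symm, F,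
      exists_reduction_of_iso_directSum hK' h⟩
  · rintro ⟨hA, F, ⟨r⟩⟩
    obtain ⟨K, hK, hK', h⟩ := r.exists_iso_directSum hC.split hA
    exact ⟨K, F, hK, hK', by rwa [freeSeq_eq_minSeq]⟩

theorem theorem4p1 {R : Type u} [CommRing R] [IsLocalRing R] (p : R)
    (hp : IsLocalRing.maximalIdeal R = Ideal.span {p})
    (hne : IsLocalRing.maximalIdeal R ≠ ⊥)
    (hsq : IsLocalRing.maximalIdeal R ^ 2 = ⊥)
    (n : ℕ) (hn : 3 ≤ n) :
    ((Even n ∨ (Odd n ∧ 2 * p = 0)) →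
      ∀ u : Rˣ, IsNAngulation (angleClass n p (u : R))) ∧
    (∀ N : Set (NSigmaSeq (FGFree R) n), IsNAngulation N →
      ∃ u : Rˣ, N = angleClass n p (u : R)) ∧
    (∀ u v : Rˣ, angleClass n p (u : R) = angleClass n p (v : R) ↔ (u : R) * p = (v : R) * p) := by
  have : NeZero n := ⟨by omega⟩
  have hC := FGFree.isRegularMod hp hne hsq
  simp only [angleClass_eq_monodromyClass hC]
  refine ⟨fun h u => isNAngulation_monodromyClass hn hC (h.imp_right And.right) u,
    fun N hN => exists_eq_monodromyClass hn hC (FGFree.unit R) FGFree.exists_units_eq_smul_id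
      FGFree.hom_ext_of_unit hN.toIsPreNAngulation, fun u v => ⟨fun h => ?_, fun h => ?_⟩⟩
  -- The minimal sequence on `R` with monodromy `u` lies in both classes, so uniqueness of the
  -- monodromy gives `p u = p v`.
  · have h' : minSeq n p ((u : R) • 𝟙 (FGFree.unit R)) ∈ monodromyClass n p (v : R) :=
      h ▸ ⟨minSeq_isCandidate hC _, FGFree.unit R, ⟨.refl _⟩⟩
    have := smul_eq_of_mem hC (.refl _) h'
    rw [smul_smul, smul_smul] at this
    rw [mul_comm, FGFree.smul_id_injective this, mul_comm]
  · have h' : ∀ F : FGFree R, minSeq n p ((u : R) • 𝟙 F) = minSeq n p ((v : R) • 𝟙 F) := fun F =>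
      minSeq_congr (by rw [smul_smul, smul_smul, mul_comm, h, mul_comm])
    simp only [monodromyClass, h']
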